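/- **Lemma (Caccioppoli).** Let $\Omega\subseteq\mathbb R^n$ be an open set (for instance a domain) and let $1<p<\infty$. Suppose that $v\in W^{1,p}(\Omega)$ is $p$-superharmonic in $\Omega$, that is, $$\int_\Omega \langle |\nabla v|^{p-2}\nabla v,\nabla\varphi\rangle\,dx\ \ge\ 0\qquad\text{for all }\varphi\in C_0^\infty(\Omega)\text{ with }\varphi\ge 0,$$ where $\nabla v$ is the weak gradient of $v$ and $C_0^\infty(\Omega)$ is the set of smooth real-valued functions with compact support in $\Omega$. Suppose also that $v>0$ almost everywhere in $\Omega$. Then $\log v$ is locally integrable in $\Omega$ and has a locally integrable weak gradient $\nabla\log v$ there, and for all $\zeta\in C_0^\infty(\Omega)$ the function $|\zeta\,\nabla\log v|^p$ is integrable over $\Omega$ and $$\int_\Omega |\zeta\,\nabla\log v|^p\,dx\ \le\ \Bigl(\frac{p}{p-1}\Bigr)^p\int_\Omega|\nabla\zeta|^p\,dx .$$ -/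

import Mathlib

open MeasureTheory TopologicalSpace
open scoped Distributions Gradient

/-- `G` is a weak (distributional) gradient of `u` in the open set `Ω`: both are locally integrable
in `Ω` and `∫_Ω u ∇φ dx = - ∫_Ω φ G dx` for every `φ ∈ C₀^∞(Ω)`. (Here `𝓓(Ω, ℝ)` is Mathlib's type of
smooth functions with compact support contained in `Ω`.) A weak gradient is unique up to
almost everywhere equality in `Ω`. -/
structure HasWeakGradient {n : ℕ} (Ω : Opens (EuclideanSpace ℝ (Fin n)))
    (u : EuclideanSpace ℝ (Fin n) → ℝ)
    (G : EuclideanSpace ℝ (Fin n) → EuclideanSpace ℝ (Fin n)) : Prop where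
  locallyIntegrableOn : LocallyIntegrableOn u (Ω : Set (EuclideanSpace ℝ (Fin n))) volume
  locallyIntegrableOn_gradient :
    LocallyIntegrableOn G (Ω : Set (EuclideanSpace ℝ (Fin n))) volume
  integral_smul_gradient : ∀ φ : 𝓓(Ω, ℝ),
    ∫ x in (Ω : Set (EuclideanSpace ℝ (Fin n))), u x • ∇ φ x =
      - ∫ x in (Ω : Set (EuclideanSpace ℝ (Fin n))), φ x • G x

/-- `u` belongs to the Sobolev space `W^{1,p}(Ω)`, with weak gradient `G`. -/
structure MemW1pWith {n : ℕ} (p : ℝ) (Ω : Opens (EuclideanSpace ℝ (Fin n)))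
    (u : EuclideanSpace ℝ (Fin n) → ℝ)
    (G : EuclideanSpace ℝ (Fin n) → EuclideanSpace ℝ (Fin n)) : Prop where
  hasWeakGradient : HasWeakGradient Ω u G
  memLp : MemLp u (ENNReal.ofReal p)
    (volume.restrict (Ω : Set (EuclideanSpace ℝ (Fin n))))
  memLp_gradient : MemLp G (ENNReal.ofReal p)
    (volume.restrict (Ω : Set (EuclideanSpace ℝ (Fin n))))

/-- `v` is `p`-superharmonic in `Ω`: `v ∈ W^{1,p}(Ω)` and
`∫_Ω ⟨|∇v|^{p-2} ∇v, ∇φ⟩ dx ≥ 0` for all `φ ∈ C₀^∞(Ω)` with `φ ≥ 0`, where `∇v = G` is the weak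
gradient. (The choice of `G` in its almost everywhere class does not matter; where `G x = 0` the
field `|G|^{p-2} G` is `0`.) -/
def IsPSuperharmonic {n : ℕ} (p : ℝ) (Ω : Opens (EuclideanSpace ℝ (Fin n)))
    (v : EuclideanSpace ℝ (Fin n) → ℝ) : Prop :=
  ∃ G : EuclideanSpace ℝ (Fin n) → EuclideanSpace ℝ (Fin n), MemW1pWith p Ω v G ∧
    ∀ φ : 𝓓(Ω, ℝ), (∀ x, 0 ≤ φ x) →
      0 ≤ ∫ x in (Ω : Set (EuclideanSpace ℝ (Fin n))),
        inner ℝ ((‖G x‖ ^ (p - 2)) • G x) (∇ φ x)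

/-! Formally one tests superharmonicity with $|\zeta|^p v^{1-p}$. The derivative of $v^{1-p}$
produces $(1-p)|\zeta|^p v^{-p}|\nabla v|^p$, and Cauchy–Schwarz bounds the remaining term. With
$X=|\zeta||\nabla v|/v$ and $Y=|\nabla\zeta|$ this reads $(p-1)\int X^p\le p\int X^{p-1}Y$. Hölder's
inequality and division by $(\int X^p)^{(p-1)/p}$ give the constant $(p/(p-1))^p$.

This test function is not smooth, so $v$ is replaced by $f+\varepsilon$ with $f\ge 0$ a
mollification of $v$, and $|t|^p$ by `regAbsPow`. For fixed $\varepsilon$ all negative powers are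
bounded, so the smoothing can be removed (`integral_caccioppoli_add_const`); the bound does not see
$\varepsilon$, and Fatou's lemma removes it (`integral_caccioppoli`).

It remains to see that $\log v$ is locally integrable with weak gradient $G/v$, where $G=\nabla v$.
The estimate puts $G/v$ in $L^1_{loc}$. A Poincaré inequality for double differences on a ball,
uniform in $\varepsilon$ for $\log(v+\varepsilon)$, then gives integrability of $\log v$
(`MemW1pWith.locallyIntegrableOn_log`). Dominated convergence transfers the weak gradient identity
from $\log(v+\varepsilon)$, and uniqueness (`HasWeakGradient.ae_eq`) covers every other choice of
gradient. -/

open Filter Topology ENNReal Convolution Set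
open scoped ContDiff

/-! ### Convergence of mollifications in $L^q$. -/

section Mollification

variable {E F : Type*} [NormedAddCommGroup E] [InnerProductSpace ℝ E] [FiniteDimensional ℝ E]
  [MeasurableSpace E] [BorelSpace E] {μ : Measure E} [μ.IsAddHaarMeasure]
  [NormedAddCommGroup F] [NormedSpace ℝ F]

-- Translations preserve $\mu$ and depend continuously on $t$; composition with such a family is
-- continuous in $L^q$ for finite $q$.
omit [NormedSpace ℝ F] in
theorem tendsto_eLpNorm_comp_sub_sub {q : ℝ≥0∞} (hq1 : 1 ≤ q) (hq : q ≠ ⊤) {f : E → F}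
    (hf : MemLp f q μ) :
    Tendsto (fun t => eLpNorm (fun x => f (x - t) - f x) q μ) (𝓝 0) (𝓝 0) := by
  have : Fact (1 ≤ q) := ⟨hq1⟩
  have hmp : ∀ t : E, MeasurePreserving (fun x => x - t) μ μ := fun t =>
    measurePreserving_sub_right μ t
  let g : E → C(E, E) := fun t => ⟨fun x => x - t, by fun_prop⟩
  have hg : Continuous g := by
    refine ContinuousMap.continuous_of_continuous_uncurry _ ?_
    exact continuous_snd.sub continuous_fst
  have h := (tendsto_const_nhds (x := hf.toLp f) (f := 𝓝 (0 : E))).compMeasurePreservingLp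
    (hg.tendsto 0) hmp (hmp 0) hq
  have h2 := tendsto_iff_edist_tendsto_0.1 h
  refine h2.congr fun t => ?_
  rw [Lp.edist_def]
  refine eLpNorm_congr_ae ?_
  have h0 := hf.coeFn_toLp
  have e1 := (Lp.coeFn_compMeasurePreserving (hf.toLp f) (hmp t)).trans
    ((hmp t).quasiMeasurePreserving.ae_eq_comp h0)
  have e2 := (Lp.coeFn_compMeasurePreserving (hf.toLp f) (hmp 0)).trans
    ((hmp 0).quasiMeasurePreserving.ae_eq_comp h0)
  filter_upwards [e1, e2] with x h1 h2
  simp only [Pi.sub_apply]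
  erw [h1, h2]
  simp

theorem lintegral_rpow_le_of_isProbabilityMeasure {α : Type*} [MeasurableSpace α] {ν : Measure α}
    [IsProbabilityMeasure ν] {q : ℝ} (hq : 1 ≤ q) {g : α → ℝ≥0∞} (hg : AEMeasurable g ν) :
    (∫⁻ x, g x ∂ν) ^ q ≤ ∫⁻ x, g x ^ q ∂ν := by
  have h := eLpNorm'_le_eLpNorm'_of_exponent_le (μ := ν) (f := g) zero_lt_one hq
    hg.aestronglyMeasurable
  simp only [eLpNorm', enorm_eq_self, rpow_one, div_one] at h
  calc _ ≤ ((∫⁻ x, g x ^ q ∂ν) ^ (1 / q)) ^ q := by gcongr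
    _ = _ := by rw [← ENNReal.rpow_mul, one_div_mul_cancel (by positivity), rpow_one]

variable [CompleteSpace F]

/-- The kernel has mass one, so the error is the average of $f(\cdot-t)-f$ for the probability
measure $\nu$ with density the kernel. Jensen's inequality and Tonelli reduce its $q$-th power to
that of the single translates, and $\nu$ only charges $t$ in the support ball. -/
theorem ContDiffBump.eLpNorm_normed_convolution_sub_le (φ : ContDiffBump (0 : E)) {q : ℝ}
    (hq : 1 ≤ q) {f : E → F} (hf : MemLp f (ENNReal.ofReal q) μ) {C : ℝ≥0∞}
    (hC : ∀ t ∈ Metric.ball (0 : E) φ.rOut,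
      eLpNorm (fun x => f (x - t) - f x) (ENNReal.ofReal q) μ ≤ C) :
    eLpNorm ((φ.normed μ ⋆[ContinuousLinearMap.lsmul ℝ ℝ, μ] f) - f) (ENNReal.ofReal q) μ ≤ C := by
  have hq0 : 0 < q := by linarith
  have hloc : LocallyIntegrable f μ := hf.locallyIntegrable (by simpa using hq)
  set ν := μ.withDensity fun t => ‖φ.normed μ t‖ₑ with hν
  have hρm : Measurable fun t => ‖φ.normed μ t‖ₑ := φ.continuous_normed.measurable.enorm
  have hνμ : ν ≪ μ := withDensity_absolutelyContinuous _ _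
  have : IsProbabilityMeasure ν := ⟨by
    rw [hν, withDensity_apply _ MeasurableSet.univ, Measure.restrict_univ,
      ← ofReal_integral_norm_eq_lintegral_enorm φ.integrable_normed]
    simp_rw [Real.norm_of_nonneg (φ.nonneg_normed _)]
    simp [φ.integral_normed]⟩
  have hF : AEStronglyMeasurable (fun z : E × E => f (z.1 - z.2) - f z.1) (μ.prod ν) := by
    have : AEStronglyMeasurable (fun z : E × E => f (z.1 - z.2) - f z.1) (μ.prod μ) :=
      (hf.1.comp_quasiMeasurePreserving (quasiMeasurePreserving_sub μ μ)).sub hf.1.comp_fst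
    exact this.mono_ac (Measure.AbsolutelyContinuous.rfl.prod hνμ)
  have hpt : ∀ x, ‖((φ.normed μ ⋆[ContinuousLinearMap.lsmul ℝ ℝ, μ] f) - f) x‖ₑ ^ q ≤
      ∫⁻ t, ‖f (x - t) - f x‖ₑ ^ q ∂ν := by
    intro x
    have hmx : AEStronglyMeasurable (fun t => f (x - t) - f x) μ :=
      (hf.1.comp_quasiMeasurePreserving (quasiMeasurePreserving_sub_left μ x)).sub
        aestronglyMeasurable_const
    have e : ((φ.normed μ ⋆[ContinuousLinearMap.lsmul ℝ ℝ, μ] f) - f) x =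
        ∫ t, φ.normed μ t • (f (x - t) - f x) ∂μ := by
      simp_rw [smul_sub]
      rw [integral_sub, φ.integral_normed_smul μ, Pi.sub_apply, convolution_def]
      · rfl
      · exact φ.hasCompactSupport_normed.convolutionExists_left
          (ContinuousLinearMap.lsmul ℝ ℝ) φ.continuous_normed hloc x
      · exact φ.integrable_normed.smul_const _
    calc _ ≤ (∫⁻ t, ‖f (x - t) - f x‖ₑ ∂ν) ^ q := by
          rw [e]
          gcongr
          refine (enorm_integral_le_lintegral_enorm _).trans_eq ?_
          rw [hν, lintegral_withDensity_eq_lintegral_mul₀ hρm.aemeasurable hmx.enorm]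
          simp [enorm_smul]
      _ ≤ _ := lintegral_rpow_le_of_isProbabilityMeasure hq (hmx.mono_ac hνμ).enorm
  have key : ∀ g : E → F, eLpNorm g (ENNReal.ofReal q) μ = (∫⁻ x, ‖g x‖ₑ ^ q ∂μ) ^ (1 / q) := by
    intro g
    rw [eLpNorm_eq_lintegral_rpow_enorm_toReal (by simpa using hq0) (by simp),
      toReal_ofReal hq0.le]
  rw [key, one_div, ENNReal.rpow_inv_le_iff hq0]
  calc _ ≤ ∫⁻ x, ∫⁻ t, ‖f (x - t) - f x‖ₑ ^ q ∂ν ∂μ := lintegral_mono hpt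
    _ = ∫⁻ t, ∫⁻ x, ‖f (x - t) - f x‖ₑ ^ q ∂μ ∂ν :=
      lintegral_lintegral_swap (hF.enorm.pow_const q)
    _ ≤ ∫⁻ _, C ^ q ∂ν := by
      refine lintegral_mono_ae ?_
      have hb : ∀ᵐ t ∂ν, t ∈ Metric.ball (0 : E) φ.rOut := by
        rw [hν, ae_withDensity_iff hρm]
        refine .of_forall fun t ht => ?_
        rw [← φ.support_normed_eq (μ := μ)]
        simpa using ht
      filter_upwards [hb] with t ht
      have := hC t ht
      rwa [key, one_div, ENNReal.rpow_inv_le_iff hq0] at this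
    _ = C ^ q := by simp

theorem ContDiffBump.tendsto_eLpNorm_normed_convolution_sub {ι : Type*} {l : Filter ι}
    {φ : ι → ContDiffBump (0 : E)} (hφ : Tendsto (fun i => (φ i).rOut) l (𝓝 0)) {q : ℝ}
    (hq : 1 ≤ q) {f : E → F} (hf : MemLp f (ENNReal.ofReal q) μ) :
    Tendsto (fun i => eLpNorm (((φ i).normed μ ⋆[ContinuousLinearMap.lsmul ℝ ℝ, μ] f) - f)
      (ENNReal.ofReal q) μ) l (𝓝 0) := by
  rw [ENNReal.tendsto_nhds_zero]
  intro ε hε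
  have h := ENNReal.tendsto_nhds_zero.1
    (tendsto_eLpNorm_comp_sub_sub (by simpa using hq) (by simp) hf) ε hε
  obtain ⟨r, hr, hr'⟩ := Metric.eventually_nhds_iff_ball.1 h
  filter_upwards [hφ.eventually_lt_const hr] with i hi
  exact (φ i).eLpNorm_normed_convolution_sub_le hq hf fun t ht =>
    hr' t (Metric.ball_subset_ball hi.le ht)

end Mollification

/-! ### Calculus rules for classical gradients. -/

section Gradient

variable {E : Type*} [NormedAddCommGroup E] [InnerProductSpace ℝ E] [CompleteSpace E]

theorem HasDerivAt.comp_hasGradientAt {f : E → ℝ} {a x : E} {g : ℝ → ℝ} {g' : ℝ}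
    (hg : HasDerivAt g g' (f x)) (hf : HasGradientAt f a x) :
    HasGradientAt (fun y => g (f y)) (g' • a) x := by
  rw [hasGradientAt_iff_hasFDerivAt] at hf ⊢
  rw [map_smul]
  exact hg.comp_hasFDerivAt x hf

theorem HasGradientAt.mul {f g : E → ℝ} {a b x : E} (hf : HasGradientAt f a x)
    (hg : HasGradientAt g b x) : HasGradientAt (fun y => f y * g y) (f x • b + g x • a) x := by
  rw [hasGradientAt_iff_hasFDerivAt] at hf hg ⊢
  rw [map_add, map_smul, map_smul]
  exact HasFDerivAt.mul hf hg

theorem ContDiff.continuous_gradient {f : E → ℝ} (hf : ContDiff ℝ 1 f) : Continuous (∇ f) :=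
  (InnerProductSpace.toDual ℝ E).symm.continuous.comp (hf.continuous_fderiv one_ne_zero)

theorem ContDiff.hasGradientAt {f : E → ℝ} (hf : ContDiff ℝ 1 f) (x : E) :
    HasGradientAt f (∇ f x) x :=
  (hf.differentiable one_ne_zero x).hasGradientAt

theorem support_gradient_subset (f : E → ℝ) : Function.support (∇ f) ⊆ tsupport f := by
  intro x hx
  apply support_fderiv_subset ℝ (f := f)
  rw [Function.mem_support] at hx ⊢
  contrapose! hx
  simp [gradient, hx]

end Gradient

/-! ### Smooth approximation in $W^{1,p}$ on compact subsets. -/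

section Approximation

variable {n : ℕ} {Ω : Opens (EuclideanSpace ℝ (Fin n))}

/-- The derivative falls on the kernel, and $y\mapsto\rho(x-y)$ is an admissible test function
because the closed ball about $x$ lies in $\Omega$. The minus sign of the reflection cancels the one
in the weak gradient identity. -/
theorem HasWeakGradient.hasGradientAt_convolution {v : EuclideanSpace ℝ (Fin n) → ℝ}
    {G : EuclideanSpace ℝ (Fin n) → EuclideanSpace ℝ (Fin n)} (h : HasWeakGradient Ω v G)
    (hv : LocallyIntegrable ((Ω : Set (EuclideanSpace ℝ (Fin n))).indicator v) volume)
    (φ : ContDiffBump (0 : EuclideanSpace ℝ (Fin n))) {x : EuclideanSpace ℝ (Fin n)}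
    (hx : Metric.closedBall x φ.rOut ⊆ Ω) :
    HasGradientAt (φ.normed volume ⋆[ContinuousLinearMap.lsmul ℝ ℝ, volume]
        (Ω : Set (EuclideanSpace ℝ (Fin n))).indicator v)
      ((φ.normed volume ⋆[ContinuousLinearMap.lsmul ℝ ℝ, volume]
        (Ω : Set (EuclideanSpace ℝ (Fin n))).indicator G) x) x := by
  have hΩm : MeasurableSet (Ω : Set (EuclideanSpace ℝ (Fin n))) := Ω.isOpen.measurableSet
  set ρ := φ.normed volume with hρ
  have hρs : ContDiff ℝ ∞ ρ := φ.contDiff_normed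
  have hρ1 : ContDiff ℝ 1 ρ := φ.contDiff_normed
  have hρc : HasCompactSupport ρ := φ.hasCompactSupport_normed
  have hsupp : tsupport (fun y => ρ (x - y)) ⊆ Metric.closedBall x φ.rOut := by
    refine closure_minimal ?_ Metric.isClosed_closedBall
    intro y hy
    have : x - y ∈ Function.support ρ := hy
    rw [hρ, φ.support_normed_eq] at this
    rw [Metric.mem_closedBall, dist_comm, dist_eq_norm]
    simpa using (mem_ball_zero_iff.1 this).le
  let ψ : 𝓓(Ω, ℝ) := ⟨fun y => ρ (x - y), hρs.comp (contDiff_const.sub contDiff_id),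
    (isCompact_closedBall x φ.rOut).of_isClosed_subset (isClosed_tsupport _) hsupp,
    hsupp.trans hx⟩
  have hψ : ∀ y, ∇ ψ y = - ∇ ρ (x - y) := by
    intro y
    refine HasGradientAt.gradient ?_
    have h1 := hasGradientAt_iff_hasFDerivAt.1 (hρ1.hasGradientAt (x - y))
    have h2 : HasFDerivAt (fun y => x - y)
      (-(ContinuousLinearMap.id ℝ (EuclideanSpace ℝ (Fin n)))) y := (hasFDerivAt_id y).const_sub x
    rw [hasGradientAt_iff_hasFDerivAt]
    refine (h1.comp y h2).congr_fderiv ?_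
    ext a
    simp
  have hw := h.integral_smul_gradient ψ
  simp only [hψ] at hw
  rw [hasGradientAt_iff_hasFDerivAt]
  refine (hρc.hasFDerivAt_convolution_left (ContinuousLinearMap.lsmul ℝ ℝ) hρ1 hv x).congr_fderiv ?_
  have hG : (ρ ⋆[ContinuousLinearMap.lsmul ℝ ℝ, volume]
      (Ω : Set (EuclideanSpace ℝ (Fin n))).indicator G) x =
      ∫ y in (Ω : Set (EuclideanSpace ℝ (Fin n))), v y • ∇ ρ (x - y) := by
    simp only [smul_neg, integral_neg, neg_inj] at hw
    rw [hw, convolution_eq_swap, ← integral_indicator hΩm]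
    refine integral_congr_ae (.of_forall fun y => ?_)
    by_cases hy : y ∈ (Ω : Set (EuclideanSpace ℝ (Fin n))) <;> simp [hy, show ψ y = ρ (x - y) from rfl]
  rw [hG]
  ext a
  have hex := (hρc.fderiv ℝ).convolutionExists_left
    ((ContinuousLinearMap.lsmul ℝ ℝ : ℝ →L[ℝ] ℝ →L[ℝ] ℝ).precompL (EuclideanSpace ℝ (Fin n)))
    (hρ1.continuous_fderiv one_ne_zero) hv x
  rw [InnerProductSpace.toDual_apply_apply, convolution_eq_swap,
    ContinuousLinearMap.integral_apply hex.integrable_swap]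
  have hint : IntegrableOn (fun y => v y • ∇ ρ (x - y)) (Ω : Set (EuclideanSpace ℝ (Fin n))) := by
    rw [← integrable_indicator_iff hΩm]
    have h2 : Integrable fun y => (Ω : Set (EuclideanSpace ℝ (Fin n))).indicator v y •
        ∇ ρ (x - y) := by
      refine hv.integrable_smul_right_of_hasCompactSupport
        (hρ1.continuous_gradient.comp (continuous_const.sub continuous_id)) ?_
      refine HasCompactSupport.of_support_subset_isCompact
        (isCompact_closedBall x φ.rOut) fun y hy => ?_
      have := support_gradient_subset ρ hy
      rw [hρ, φ.tsupport_normed_eq] at this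
      rw [Metric.mem_closedBall, dist_comm, dist_eq_norm]
      simpa using this
    refine h2.congr (.of_forall fun y => ?_)
    by_cases hy : y ∈ (Ω : Set (EuclideanSpace ℝ (Fin n))) <;> simp [hy]
  symm
  rw [real_inner_comm, ← integral_inner hint, ← integral_indicator hΩm]
  refine integral_congr_ae (.of_forall fun y => ?_)
  by_cases hy : y ∈ (Ω : Set (EuclideanSpace ℝ (Fin n)))
  · simp [hy, inner_smul_right, inner_gradient_right, mul_comm]
  · simp [hy]

/-- The zero extensions of $v$ and $G$ are mollified at radii below the distance by which $K$ can be
thickened inside $\Omega$, so on $K$ mollification commutes with the gradient. The kernel is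
nonnegative, hence so are the approximants. -/
theorem exists_smooth_approximation {p : ℝ} (hp : 1 ≤ p) {v : EuclideanSpace ℝ (Fin n) → ℝ}
    {G : EuclideanSpace ℝ (Fin n) → EuclideanSpace ℝ (Fin n)} (h : MemW1pWith p Ω v G)
    (hpos : ∀ᵐ x ∂(volume.restrict (Ω : Set (EuclideanSpace ℝ (Fin n)))), 0 ≤ v x)
    {K : Set (EuclideanSpace ℝ (Fin n))} (hK : IsCompact K) (hKΩ : K ⊆ Ω) :
    ∃ f : ℕ → EuclideanSpace ℝ (Fin n) → ℝ, (∀ k, ContDiff ℝ ∞ (f k)) ∧ (∀ k x, 0 ≤ f k x) ∧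
      Tendsto (fun k => eLpNorm (f k - v) (ENNReal.ofReal p) (volume.restrict K)) atTop (𝓝 0) ∧
      Tendsto (fun k => eLpNorm (∇ (f k) - G) (ENNReal.ofReal p) (volume.restrict K)) atTop
        (𝓝 0) ∧
      (∀ᵐ x ∂(volume.restrict K), Tendsto (fun k => f k x) atTop (𝓝 (v x))) := by
  have hΩm : MeasurableSet (Ω : Set (EuclideanSpace ℝ (Fin n))) := Ω.isOpen.measurableSet
  have hKm := hK.measurableSet
  obtain ⟨r, hr, hrΩ⟩ := hK.exists_cthickening_subset_open Ω.isOpen hKΩ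
  -- The ratio 2 of outer to inner radius stays fixed: pointwise a.e. convergence needs this ratio
  -- bounded.
  let φ : ℕ → ContDiffBump (0 : EuclideanSpace ℝ (Fin n)) := fun k =>
    ⟨r / (k + 1) / 2, r / (k + 1), by positivity, half_lt_self (by positivity)⟩
  have hφr : ∀ k, (φ k).rOut = r / (k + 1) := fun _ => rfl
  have hφle : ∀ k, (φ k).rOut ≤ r := fun k => by
    rw [hφr]
    exact div_le_self hr.le (by linarith [(Nat.cast_nonneg k : (0 : ℝ) ≤ k)])
  have hφ0 : Tendsto (fun k => (φ k).rOut) atTop (𝓝 0) := by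
    simp_rw [hφr]
    exact tendsto_const_nhds.div_atTop (tendsto_natCast_atTop_atTop.atTop_add tendsto_const_nhds)
  have hv : MemLp ((Ω : Set (EuclideanSpace ℝ (Fin n))).indicator v) (ENNReal.ofReal p) volume :=
    (memLp_indicator_iff_restrict hΩm).2 h.memLp
  have hG : MemLp ((Ω : Set (EuclideanSpace ℝ (Fin n))).indicator G) (ENNReal.ofReal p) volume :=
    (memLp_indicator_iff_restrict hΩm).2 h.memLp_gradient
  have hvl : LocallyIntegrable ((Ω : Set (EuclideanSpace ℝ (Fin n))).indicator v) volume :=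
    hv.locallyIntegrable (by simpa using hp)
  have hvi : ∀ᵐ x, 0 ≤ (Ω : Set (EuclideanSpace ℝ (Fin n))).indicator v x := by
    filter_upwards [(ae_restrict_iff' hΩm).1 hpos] with x hx
    exact indicator_apply_nonneg hx
  refine ⟨fun k => (φ k).normed volume ⋆[ContinuousLinearMap.lsmul ℝ ℝ, volume]
    (Ω : Set (EuclideanSpace ℝ (Fin n))).indicator v, fun k => ?_, fun k x => ?_, ?_, ?_, ?_⟩
  · exact (φ k).hasCompactSupport_normed.contDiff_convolution_left _ (φ k).contDiff_normed hvl
  · simp only [convolution_eq_swap]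
    refine integral_nonneg_of_ae ?_
    filter_upwards [hvi] with y hy
    exact mul_nonneg ((φ k).nonneg_normed _) hy
  · have h1 := ContDiffBump.tendsto_eLpNorm_normed_convolution_sub hφ0 hp hv
    refine tendsto_of_tendsto_of_tendsto_of_le_of_le tendsto_const_nhds h1
      (fun _ => zero_le) fun k => ?_
    refine le_trans (le_of_eq ?_) (eLpNorm_mono_measure _ (Measure.restrict_le_self (s := K)))
    refine eLpNorm_congr_ae ((ae_restrict_iff' hKm).2 (.of_forall fun x hx => ?_))
    simp [hKΩ hx]
  · have h1 := ContDiffBump.tendsto_eLpNorm_normed_convolution_sub hφ0 hp hG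
    refine tendsto_of_tendsto_of_tendsto_of_le_of_le tendsto_const_nhds h1
      (fun _ => zero_le) fun k => ?_
    refine le_trans (le_of_eq ?_) (eLpNorm_mono_measure _ (Measure.restrict_le_self (s := K)))
    refine eLpNorm_congr_ae ((ae_restrict_iff' hKm).2 (.of_forall fun x hx => ?_))
    have hx' : Metric.closedBall x (φ k).rOut ⊆ Ω :=
      ((Metric.closedBall_subset_closedBall (hφle k)).trans
        (Metric.closedBall_subset_cthickening hx r)).trans hrΩ
    simp [hKΩ hx, (h.hasWeakGradient.hasGradientAt_convolution hvl (φ k) hx').gradient]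
  · have h1 := ContDiffBump.ae_convolution_tendsto_right_of_locallyIntegrable (K := 2) hφ0
      (.of_forall fun k => by simp [φ]; linarith) hvl
    refine (ae_restrict_iff' hKm).2 ?_
    filter_upwards [h1] with x hx hxK
    simpa [hKΩ hxK] using hx

end Approximation

/-! ### Limits of weighted integrals, and absorption by Hölder. -/

section Integration

variable {α F : Type*} [MeasurableSpace α] {μ : Measure α} [NormedAddCommGroup F] [NormedSpace ℝ F]

/-- Split $a_kh_k-a_0h_0=a_k(h_k-h_0)+(a_k-a_0)h_0$: the first term is at most $C$ times an $L^1$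
error, the second is dominated by $2C|h_0|$. -/
theorem tendsto_eLpNorm_one_smul_sub {a : ℕ → α → ℝ} {a₀ : α → ℝ} {h : ℕ → α → F} {h₀ : α → F}
    {C : ℝ} (ha : ∀ k, AEStronglyMeasurable (a k) μ) (hC : ∀ k x, ‖a k x‖ ≤ C)
    (hlim : ∀ᵐ x ∂μ, Tendsto (fun k => a k x) atTop (𝓝 (a₀ x))) (hh₀ : Integrable h₀ μ)
    (hconv : Tendsto (fun k => eLpNorm (h k - h₀) 1 μ) atTop (𝓝 0)) :
    Tendsto (fun k => eLpNorm ((fun x => a k x • h k x) - fun x => a₀ x • h₀ x) 1 μ)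
      atTop (𝓝 0) := by
  have ha₀ : AEStronglyMeasurable a₀ μ := aestronglyMeasurable_of_tendsto_ae atTop ha hlim
  have h1 : Tendsto (fun k => ∫⁻ x, ‖(a k x - a₀ x) • h₀ x‖ₑ ∂μ) atTop (𝓝 (∫⁻ _, 0 ∂μ)) := by
    have hb : ∀ᵐ x ∂μ, ‖a₀ x‖ ≤ C := by
      filter_upwards [hlim] with x hx
      exact le_of_tendsto hx.norm (.of_forall fun k => hC k x)
    refine tendsto_lintegral_of_dominated_convergence' (fun x => ‖(2 * C) • h₀ x‖ₑ)
      (fun k => (((ha k).sub ha₀).smul hh₀.1).enorm) (fun k => ?_) (hh₀.smul (2 * C)).2.ne ?_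
    · filter_upwards [hb] with x hx
      rw [enorm_le_iff_norm_le, norm_smul, norm_smul]
      gcongr
      refine (norm_sub_le _ _).trans (le_trans ?_ (le_abs_self _))
      linarith [hC k x]
    · filter_upwards [hlim] with x hx
      have : Tendsto (fun k => ‖(a k x - a₀ x) • h₀ x‖ₑ) atTop (𝓝 ‖(a₀ x - a₀ x) • h₀ x‖ₑ) :=
        ((hx.sub_const _).smul_const _).enorm
      simpa using this
  have h2 : Tendsto (fun k => ENNReal.ofReal C * eLpNorm (h k - h₀) 1 μ) atTop (𝓝 0) := by
    simpa using ENNReal.Tendsto.const_mul hconv (Or.inr ENNReal.ofReal_ne_top)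
  have h3 := h2.add h1
  rw [lintegral_zero, add_zero] at h3
  refine tendsto_of_tendsto_of_tendsto_of_le_of_le tendsto_const_nhds h3
    (fun _ => zero_le) fun k => ?_
  simp only [eLpNorm_one_eq_lintegral_enorm]
  have hm : AEMeasurable (fun x => ‖(a k x - a₀ x) • h₀ x‖ₑ) μ :=
    (((ha k).sub ha₀).smul hh₀.1).enorm
  rw [← lintegral_const_mul' _ _ ENNReal.ofReal_ne_top, ← lintegral_add_right' _ hm]
  refine lintegral_mono fun x => ?_
  have e : a k x • h k x - a₀ x • h₀ x = a k x • (h k x - h₀ x) + (a k x - a₀ x) • h₀ x := by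
    module
  simp only [Pi.sub_apply]
  rw [e]
  refine (enorm_add_le _ _).trans ?_
  gcongr
  rw [enorm_smul]
  gcongr
  rw [← ofReal_norm]
  exact ENNReal.ofReal_le_ofReal (hC k x)

theorem tendsto_integral_smul_of_tendsto_eLpNorm_one {a : ℕ → α → ℝ} {a₀ : α → ℝ} {h : ℕ → α → F}
    {h₀ : α → F} {C : ℝ} (ha : ∀ k, AEStronglyMeasurable (a k) μ) (hC : ∀ k x, ‖a k x‖ ≤ C)
    (hlim : ∀ᵐ x ∂μ, Tendsto (fun k => a k x) atTop (𝓝 (a₀ x)))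
    (hh : ∀ k, Integrable (h k) μ) (hh₀ : Integrable h₀ μ)
    (hconv : Tendsto (fun k => eLpNorm (h k - h₀) 1 μ) atTop (𝓝 0)) :
    Tendsto (fun k => ∫ x, a k x • h k x ∂μ) atTop (𝓝 (∫ x, a₀ x • h₀ x ∂μ)) := by
  have ha₀ : AEStronglyMeasurable a₀ μ := aestronglyMeasurable_of_tendsto_ae atTop ha hlim
  exact tendsto_integral_of_L1' _ (ha₀.smul hh₀.1)
    (.of_forall fun k => (hh k).bdd_smul C (ha k) (.of_forall (hC k)))
    (tendsto_eLpNorm_one_smul_sub ha hC hlim hh₀ hconv)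

/-- Hölder with exponents $p/(p-1)$ and $p$ leaves a factor $(\int X^p)^{(p-1)/p}$ on the right,
which is divided out. This is where $X\in L^p$ must be known beforehand. -/
theorem integral_rpow_le_of_mul_integral_rpow_le {p : ℝ} (hp : 1 < p) {X Y : α → ℝ}
    (hX : 0 ≤ᵐ[μ] X) (hY : 0 ≤ᵐ[μ] Y) (hXp : MemLp X (ENNReal.ofReal p) μ)
    (hYp : MemLp Y (ENNReal.ofReal p) μ)
    (h : (p - 1) * ∫ x, X x ^ p ∂μ ≤ p * ∫ x, X x ^ (p - 1) * Y x ∂μ) :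
    ∫ x, X x ^ p ∂μ ≤ (p / (p - 1)) ^ p * ∫ x, Y x ^ p ∂μ := by
  have hp1 : 0 < p - 1 := by linarith
  have hp0 : 0 < p := by linarith
  have hc : (p / (p - 1)).HolderConjugate p := (Real.HolderConjugate.conjExponent hp).symm
  have hA : 0 ≤ ∫ x, X x ^ p ∂μ := integral_nonneg_of_ae <| by
    filter_upwards [hX] with x hx using Real.rpow_nonneg hx _
  have hB : 0 ≤ ∫ x, Y x ^ p ∂μ := integral_nonneg_of_ae <| by
    filter_upwards [hY] with x hx using Real.rpow_nonneg hx _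
  have hXq : MemLp (fun x => X x ^ (p - 1)) (ENNReal.ofReal (p / (p - 1))) μ := by
    have := hXp.norm_rpow_div (ENNReal.ofReal (p - 1))
    rw [toReal_ofReal hp1.le, ← ENNReal.ofReal_div_of_pos hp1] at this
    refine (memLp_congr_ae ?_).1 this
    filter_upwards [hX] with x hx
    rw [Real.norm_of_nonneg hx]
  have hol := integral_mul_le_Lp_mul_Lq_of_nonneg hc
    (by filter_upwards [hX] with x hx using Real.rpow_nonneg hx _) hY hXq hYp
  have e1 : ∫ x, (X x ^ (p - 1)) ^ (p / (p - 1)) ∂μ = ∫ x, X x ^ p ∂μ := by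
    refine integral_congr_ae ?_
    filter_upwards [hX] with x hx
    rw [← Real.rpow_mul hx, mul_div_cancel₀ _ hp1.ne']
  rw [e1] at hol
  set A := ∫ x, X x ^ p ∂μ
  set B := ∫ x, Y x ^ p ∂μ
  rcases hA.eq_or_lt with hA0 | hA0
  · rw [← hA0]
    positivity
  have e2 : A = A ^ (1 / (p / (p - 1))) * A ^ (1 / p) := by
    rw [← Real.rpow_add hA0]
    have : 1 / (p / (p - 1)) + 1 / p = 1 := by field_simp; ring
    rw [this, Real.rpow_one]
  have hpos : 0 < A ^ (1 / (p / (p - 1))) := Real.rpow_pos_of_pos hA0 _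
  have h3 : A ^ (1 / p) ≤ p / (p - 1) * B ^ (1 / p) := by
    rw [div_mul_eq_mul_div, le_div_iff₀ hp1]
    refine le_of_mul_le_mul_left ?_ hpos
    calc _ = (p - 1) * (A ^ (1 / (p / (p - 1))) * A ^ (1 / p)) := by ring
      _ = (p - 1) * A := by rw [← e2]
      _ ≤ _ := h
      _ ≤ p * (A ^ (1 / (p / (p - 1))) * B ^ (1 / p)) := by gcongr
      _ = _ := by ring
  calc A = (A ^ (1 / p)) ^ p := by rw [← Real.rpow_mul hA, one_div_mul_cancel hp0.ne', Real.rpow_one]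
    _ ≤ (p / (p - 1) * B ^ (1 / p)) ^ p := by gcongr
    _ = _ := by
      rw [Real.mul_rpow (by positivity) (by positivity), ← Real.rpow_mul hB,
        one_div_mul_cancel hp0.ne', Real.rpow_one]

end Integration

/-! ### The estimate with $v+\varepsilon$ in the denominator. -/

section Caccioppoli

variable {n : ℕ} {Ω : Opens (EuclideanSpace ℝ (Fin n))} {p : ℝ}
  {v : EuclideanSpace ℝ (Fin n) → ℝ} {G : EuclideanSpace ℝ (Fin n) → EuclideanSpace ℝ (Fin n)}

theorem norm_rpow_sub_two_smul {E : Type*} [NormedAddCommGroup E] [NormedSpace ℝ E] (hp : 1 < p)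
    (g : E) : ‖‖g‖ ^ (p - 2) • g‖ = ‖g‖ ^ (p - 1) := by
  rw [norm_smul, Real.norm_of_nonneg (by positivity)]
  rcases eq_or_ne g 0 with rfl | hg
  · simp [Real.zero_rpow (by linarith : p - 1 ≠ 0)]
  · rw [← Real.rpow_add_one (norm_ne_zero_iff.2 hg)]
    congr 1
    ring

theorem inner_norm_rpow_sub_two_smul {E : Type*} [NormedAddCommGroup E] [InnerProductSpace ℝ E]
    (hp : 1 < p) (g : E) : inner ℝ (‖g‖ ^ (p - 2) • g) g = ‖g‖ ^ p := by
  rw [real_inner_smul_left, real_inner_self_eq_norm_sq]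
  rcases eq_or_ne g 0 with rfl | hg
  · simp [Real.zero_rpow (by linarith : p ≠ 0)]
  · rw [← Real.rpow_natCast ‖g‖ 2, ← Real.rpow_add (norm_pos_iff.2 hg)]
    norm_num

theorem memLp_norm_rpow_sub_two_smul {μ : Measure (EuclideanSpace ℝ (Fin n))} (hp : 1 < p)
    (hG : MemLp G (ENNReal.ofReal p) μ) :
    MemLp (fun x => ‖G x‖ ^ (p - 2) • G x) (ENNReal.ofReal (p / (p - 1))) μ := by
  have hp1 : 0 < p - 1 := by linarith
  have := hG.norm_rpow_div (ENNReal.ofReal (p - 1))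
  rw [toReal_ofReal hp1.le, ← ENNReal.ofReal_div_of_pos hp1] at this
  refine (memLp_congr_norm ?_ this.1 (.of_forall fun x => ?_)).2 this
  · have hm : AEMeasurable (fun x => ‖G x‖ ^ (p - 2)) μ := hG.1.norm.aemeasurable.pow_const _
    exact hm.aestronglyMeasurable.smul hG.1
  · rw [norm_rpow_sub_two_smul hp, Real.norm_of_nonneg (by positivity)]

/-- The regularisation `(t² + d)^{p/2} - d^{p/2}` of `|t|^p`, smooth for `d > 0`. -/
noncomputable def regAbsPow (p d t : ℝ) : ℝ := (t ^ 2 + d) ^ (p / 2) - d ^ (p / 2)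

theorem regAbsPow_nonneg (hp : 0 ≤ p) {d : ℝ} (hd : 0 ≤ d) (t : ℝ) : 0 ≤ regAbsPow p d t := by
  refine sub_nonneg.2 (Real.rpow_le_rpow hd ?_ (by positivity))
  nlinarith [sq_nonneg t]

theorem contDiff_regAbsPow {d : ℝ} (hd : 0 < d) : ContDiff ℝ ∞ (regAbsPow p d) :=
  (((contDiff_id.pow 2).add contDiff_const).rpow_const_of_ne
    fun t => by simp only [id]; positivity).sub contDiff_const

theorem hasDerivAt_regAbsPow {d : ℝ} (hd : 0 < d) (t : ℝ) :
    HasDerivAt (regAbsPow p d) (p * t * (t ^ 2 + d) ^ (p / 2 - 1)) t := by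
  have h : HasDerivAt (fun t : ℝ => t ^ 2 + d) (2 * t) t := by
    simpa using (hasDerivAt_pow 2 t).add_const d
  have h2 := (h.rpow_const (p := p / 2) (Or.inl (by positivity))).sub_const (d ^ (p / 2))
  exact h2.congr_deriv (by ring)

/-- The factor $|t|$ is absorbed through $|t|\le(t^2+d)^{1/2}$. The resulting bound has a
nonnegative exponent, so it is locally bounded uniformly for $d\le 1$ and tends to $p|t|^{p-1}$ as
$d\to0$. -/
theorem abs_deriv_regAbsPow_le (hp : 0 ≤ p) {d : ℝ} (hd : 0 < d) (t : ℝ) :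
    |p * t * (t ^ 2 + d) ^ (p / 2 - 1)| ≤ p * (t ^ 2 + d) ^ ((p - 1) / 2) := by
  have h0 : 0 < t ^ 2 + d := by positivity
  rw [abs_mul, abs_mul, abs_of_nonneg hp, abs_of_pos (Real.rpow_pos_of_pos h0 _), mul_assoc]
  refine mul_le_mul_of_nonneg_left ?_ hp
  have h1 : |t| ≤ (t ^ 2 + d) ^ (1 / 2 : ℝ) := by
    rw [← Real.sqrt_eq_rpow]
    exact Real.abs_le_sqrt (by linarith)
  calc _ ≤ (t ^ 2 + d) ^ (1 / 2 : ℝ) * (t ^ 2 + d) ^ (p / 2 - 1) := by gcongr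
    _ = _ := by
      rw [← Real.rpow_add h0]
      ring_nf

theorem tendsto_sq_add_rpow {ι : Type*} {l : Filter ι} {d : ι → ℝ} (hd : Tendsto d l (𝓝 0))
    {s : ℝ} (hs : 0 ≤ s) (t : ℝ) :
    Tendsto (fun i => (t ^ 2 + d i) ^ (s / 2)) l (𝓝 (|t| ^ s)) := by
  have h : Tendsto (fun i => (t ^ 2 + d i) ^ (s / 2)) l (𝓝 ((t ^ 2 + 0) ^ (s / 2))) :=
    (tendsto_const_nhds.add hd).rpow_const (Or.inr (by positivity))
  convert h using 2
  rw [add_zero, ← sq_abs t, ← Real.rpow_natCast, ← Real.rpow_mul (abs_nonneg t)]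
  congr 1
  push_cast
  ring

theorem tendsto_regAbsPow {ι : Type*} {l : Filter ι} {d : ι → ℝ} (hd : Tendsto d l (𝓝 0))
    (hp : 0 < p) (t : ℝ) : Tendsto (fun i => regAbsPow p (d i) t) l (𝓝 (|t| ^ p)) := by
  have h := (tendsto_sq_add_rpow hd hp.le t).sub
    (hd.rpow_const (p := p / 2) (Or.inr (by positivity)))
  simpa [regAbsPow, Real.zero_rpow (by positivity : p / 2 ≠ 0)] using h

/-- The inequality obtained by testing with `η(ζ) (f + ε)^{1-p}`, `f` smooth and nonnegative. -/
theorem integral_inner_le_of_superharmonic_test (hp : 1 < p) (hG : MemW1pWith p Ω v G)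
    (hsup : ∀ φ : 𝓓(Ω, ℝ), (∀ x, 0 ≤ φ x) →
      0 ≤ ∫ x in (Ω : Set (EuclideanSpace ℝ (Fin n))), inner ℝ ((‖G x‖ ^ (p - 2)) • G x) (∇ φ x))
    (ζ : 𝓓(Ω, ℝ)) {f : EuclideanSpace ℝ (Fin n) → ℝ} (hf : ContDiff ℝ ∞ f) (hf0 : ∀ x, 0 ≤ f x)
    {ε d : ℝ} (hε : 0 < ε) (hd : 0 < d) :
    (p - 1) * ∫ x in tsupport ζ, (regAbsPow p d (ζ x) * (f x + ε) ^ (-p)) •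
        inner ℝ ((‖G x‖ ^ (p - 2)) • G x) (∇ f x) ≤
      p * ∫ x in tsupport ζ, ((f x + ε) ^ (1 - p) * (ζ x ^ 2 + d) ^ ((p - 1) / 2)) •
        (‖(‖G x‖ ^ (p - 2)) • G x‖ * ‖∇ ζ x‖) := by
  have hfε : ∀ x, 0 < f x + ε := fun x => by linarith [hf0 x]
  have hK : IsCompact (tsupport ζ) := ζ.hasCompactSupport
  set W := fun x => (‖G x‖ ^ (p - 2)) • G x with hW
  have hsuppη : ∀ x ∉ tsupport ζ, regAbsPow p d (ζ x) = 0 := fun x hx => by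
    simp [image_eq_zero_of_notMem_tsupport hx, regAbsPow]
  -- The support stays inside that of $\zeta$ because `regAbsPow` vanishes at $0$, thanks to the
  -- subtracted $d^{p/2}$.
  let φ : 𝓓(Ω, ℝ) := ⟨fun x => regAbsPow p d (ζ x) * (f x + ε) ^ (1 - p),
    ((contDiff_regAbsPow hd).comp ζ.contDiff).mul
      ((hf.add contDiff_const).rpow_const_of_ne fun x => (hfε x).ne'),
    HasCompactSupport.intro hK fun x hx => by rw [hsuppη x hx, zero_mul],
    (closure_minimal (fun x hx => by
      by_contra h
      exact hx (by simp [hsuppη x h])) (isClosed_tsupport ζ)).trans ζ.tsupport_subset⟩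
  have hφ : ∀ x, φ x = regAbsPow p d (ζ x) * (f x + ε) ^ (1 - p) := fun _ => rfl
  have hφK : tsupport φ ⊆ tsupport ζ := closure_minimal (fun x hx => by
      by_contra h
      exact hx (by rw [hφ, hsuppη x h, zero_mul])) (isClosed_tsupport ζ)
  have hgrad : ∀ x, ∇ φ x =
      regAbsPow p d (ζ x) • (((1 - p) * (f x + ε) ^ (-p)) • ∇ f x) +
      (f x + ε) ^ (1 - p) • ((p * ζ x * (ζ x ^ 2 + d) ^ (p / 2 - 1)) • ∇ ζ x) := by
    intro x
    refine HasGradientAt.gradient ?_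
    have hζ1 := (ζ.contDiff.of_le (m := 1) (by norm_cast)).hasGradientAt x
    have hf1 := (hf.of_le (m := 1) (by norm_cast)).hasGradientAt x
    refine HasGradientAt.mul ((hasDerivAt_regAbsPow hd (ζ x)).comp_hasGradientAt hζ1)
      (HasDerivAt.comp_hasGradientAt (g := fun s => (s + ε) ^ (1 - p)) ?_ hf1)
    have := ((hasDerivAt_id (f x)).add_const ε).rpow_const (p := 1 - p) (Or.inl (hfε x).ne')
    simpa using this
  have h0 := hsup φ fun x => mul_nonneg (regAbsPow_nonneg (by linarith) hd.le _)
    (Real.rpow_nonneg (hfε x).le _)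
  rw [setIntegral_eq_of_subset_of_forall_sdiff_eq_zero Ω.isOpen.measurableSet ζ.tsupport_subset
    (fun x hx => ?_)] at h0
  swap
  · have : ∇ φ x = 0 := by
      by_contra h
      exact hx.2 (hφK (support_gradient_subset φ h))
    rw [this, inner_zero_right]
  have hfin : IsFiniteMeasure (volume.restrict (tsupport ζ)) :=
    isFiniteMeasure_restrict.2 hK.measure_lt_top.ne
  have hWint : IntegrableOn W (tsupport ζ) := by
    have h1 := memLp_norm_rpow_sub_two_smul hp
      (hG.memLp_gradient.mono_measure (Measure.restrict_mono ζ.tsupport_subset le_rfl))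
    refine h1.integrable ?_
    rw [ENNReal.one_le_ofReal, one_le_div (by linarith)]
    linarith
  have hcont : Continuous fun x => f x + ε := hf.continuous.add continuous_const
  have hζc := ζ.continuous
  have hfg : Continuous (∇ f) :=
    (hf.of_le (m := 1) (by norm_cast)).continuous_gradient
  have hζg : Continuous (∇ ζ) :=
    (ζ.contDiff.of_le (m := 1) (by norm_cast)).continuous_gradient
  have hI : ∀ (b : EuclideanSpace ℝ (Fin n) → ℝ)
      (w : EuclideanSpace ℝ (Fin n) → EuclideanSpace ℝ (Fin n)), Continuous b → Continuous w →
      IntegrableOn (fun x => b x • inner ℝ (W x) (w x)) (tsupport ζ) := by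
    intro b w hb hw
    refine IntegrableOn.continuousOn_smul ?_ hb.continuousOn hK
    refine Integrable.mono' (IntegrableOn.mul_continuousOn hWint.norm hw.norm.continuousOn hK)
      (hWint.1.inner hw.aestronglyMeasurable) (.of_forall fun x => norm_inner_le_norm _ _)
  have hsq : ∀ s : ℝ, Continuous fun x => (ζ x ^ 2 + d) ^ s := by
    intro s
    have : Continuous fun x => ζ x ^ 2 + d := by fun_prop
    exact this.rpow_const fun x => Or.inl (by positivity)
  have hfp : ∀ s : ℝ, Continuous fun x => (f x + ε) ^ s := fun s =>
    hcont.rpow_const fun x => Or.inl (hfε x).ne'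
  have hI1 := hI (fun x => regAbsPow p d (ζ x) * (f x + ε) ^ (-p)) (∇ f)
    (((contDiff_regAbsPow hd).continuous.comp hζc).mul (hfp _)) hfg
  have hI2 : IntegrableOn (fun x => ((f x + ε) ^ (1 - p) * (ζ x ^ 2 + d) ^ ((p - 1) / 2)) •
        (‖W x‖ * ‖∇ ζ x‖)) (tsupport ζ) :=
    (IntegrableOn.mul_continuousOn hWint.norm hζg.norm.continuousOn hK).continuousOn_smul
      ((hfp _).mul (hsq _)).continuousOn hK
  have hI3 := hI (fun x => (f x + ε) ^ (1 - p) * (p * ζ x * (ζ x ^ 2 + d) ^ (p / 2 - 1))) (∇ ζ)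
    ((hfp _).mul ((continuous_const.mul hζc).mul (hsq _))) hζg
  have e : ∀ x, inner ℝ (W x) (∇ φ x) =
      (1 - p) * ((regAbsPow p d (ζ x) * (f x + ε) ^ (-p)) • inner ℝ (W x) (∇ f x)) +
      ((f x + ε) ^ (1 - p) * (p * ζ x * (ζ x ^ 2 + d) ^ (p / 2 - 1))) •
        inner ℝ (W x) (∇ ζ x) := by
    intro x
    rw [hgrad, inner_add_right]
    simp only [inner_smul_right, smul_eq_mul]
    ring
  have h1 : ∫ x in tsupport ζ, inner ℝ (W x) (∇ φ x) =
      (1 - p) * (∫ x in tsupport ζ, (regAbsPow p d (ζ x) * (f x + ε) ^ (-p)) •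
        inner ℝ (W x) (∇ f x)) +
      ∫ x in tsupport ζ, ((f x + ε) ^ (1 - p) * (p * ζ x * (ζ x ^ 2 + d) ^ (p / 2 - 1))) •
        inner ℝ (W x) (∇ ζ x) := by
    simp_rw [e]
    rw [integral_add (hI1.const_mul _) hI3, integral_const_mul]
  have h2 : ∫ x in tsupport ζ, ((f x + ε) ^ (1 - p) *
        (p * ζ x * (ζ x ^ 2 + d) ^ (p / 2 - 1))) • inner ℝ (W x) (∇ ζ x) ≤
      p * ∫ x in tsupport ζ, ((f x + ε) ^ (1 - p) * (ζ x ^ 2 + d) ^ ((p - 1) / 2)) •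
        (‖W x‖ * ‖∇ ζ x‖) := by
    rw [← integral_const_mul]
    refine integral_mono hI3 (hI2.const_mul _) fun x => ?_
    simp only [smul_eq_mul]
    have hA := abs_deriv_regAbsPow_le (p := p) (by linarith) hd (ζ x)
    have hB := abs_real_inner_le_norm (W x) (∇ ζ x)
    have hC : 0 ≤ (f x + ε) ^ (1 - p) := Real.rpow_nonneg (hfε x).le _
    calc _ = (f x + ε) ^ (1 - p) * ((p * ζ x * (ζ x ^ 2 + d) ^ (p / 2 - 1)) *
          inner ℝ (W x) (∇ ζ x)) := by ring
      _ ≤ (f x + ε) ^ (1 - p) * (|p * ζ x * (ζ x ^ 2 + d) ^ (p / 2 - 1)| *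
          |inner ℝ (W x) (∇ ζ x)|) := by
        rw [← abs_mul]
        exact mul_le_mul_of_nonneg_left (le_abs_self _) hC
      _ ≤ (f x + ε) ^ (1 - p) * ((p * (ζ x ^ 2 + d) ^ ((p - 1) / 2)) *
          (‖W x‖ * ‖∇ ζ x‖)) := by gcongr
      _ = _ := by ring
  linarith

/-- Let the mollification and the parameter $d$ tend to their limits together in the tested
inequality, with $\varepsilon$ fixed, then absorb by Hölder. -/
theorem integral_caccioppoli_add_const (hp : 1 < p) (hG : MemW1pWith p Ω v G)
    (hsup : ∀ φ : 𝓓(Ω, ℝ), (∀ x, 0 ≤ φ x) →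
      0 ≤ ∫ x in (Ω : Set (EuclideanSpace ℝ (Fin n))), inner ℝ ((‖G x‖ ^ (p - 2)) • G x) (∇ φ x))
    (hpos : ∀ᵐ x ∂(volume.restrict (Ω : Set (EuclideanSpace ℝ (Fin n)))), 0 ≤ v x)
    (ζ : 𝓓(Ω, ℝ)) {ε : ℝ} (hε : 0 < ε) :
    IntegrableOn (fun x => (|ζ x| * ‖G x‖ / (v x + ε)) ^ p) (tsupport ζ) ∧
    ∫ x in tsupport ζ, (|ζ x| * ‖G x‖ / (v x + ε)) ^ p ≤
      (p / (p - 1)) ^ p * ∫ x in tsupport ζ, ‖∇ ζ x‖ ^ p := by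
  have hK : IsCompact (tsupport ζ) := ζ.hasCompactSupport
  have hp0 : 0 < p := by linarith
  have hp1 : 0 < p - 1 := by linarith
  have hfin : IsFiniteMeasure (volume.restrict (tsupport ζ)) :=
    isFiniteMeasure_restrict.2 hK.measure_lt_top.ne
  have hle : volume.restrict (tsupport ζ) ≤
      volume.restrict (Ω : Set (EuclideanSpace ℝ (Fin n))) :=
    Measure.restrict_mono ζ.tsupport_subset le_rfl
  set μ := volume.restrict (tsupport ζ) with hμ
  have hGm : MemLp G (ENNReal.ofReal p) μ := hG.memLp_gradient.mono_measure hle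
  have hvm : MemLp v (ENNReal.ofReal p) μ := hG.memLp.mono_measure hle
  have hv0 : ∀ᵐ x ∂μ, 0 ≤ v x := ae_mono hle hpos
  set W := fun x => (‖G x‖ ^ (p - 2)) • G x with hW
  have hWm : MemLp W (ENNReal.ofReal (p / (p - 1))) μ := memLp_norm_rpow_sub_two_smul hp hGm
  have hpq : ENNReal.HolderTriple (ENNReal.ofReal (p / (p - 1))) (ENNReal.ofReal p) 1 := by
    have := (Real.HolderConjugate.conjExponent hp).symm
    exact this.ennrealOfReal
  obtain ⟨M, hM⟩ := ζ.hasCompactSupport.exists_bound_of_continuous ζ.continuous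
  obtain ⟨f, hf, hf0, hfv, hfG, hfae⟩ := exists_smooth_approximation hp.le hG hpos hK
    ζ.tsupport_subset
  let d : ℕ → ℝ := fun k => 1 / ((k : ℝ) + 1)
  have hd0 : ∀ k, 0 < d k := fun k => by positivity
  have hd1 : ∀ k, d k ≤ 1 := fun k => by
    simp only [d]
    rw [div_le_one (by positivity)]
    linarith [(Nat.cast_nonneg k : (0 : ℝ) ≤ k)]
  have hd : Tendsto d atTop (𝓝 0) := tendsto_one_div_add_atTop_nhds_zero_nat
  have hζc := ζ.continuous
  have hζg : Continuous (∇ ζ) := (ζ.contDiff.of_le (m := 1) (by norm_cast)).continuous_gradient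
  obtain ⟨M', hM'⟩ := hK.exists_bound_of_continuousOn hζg.continuousOn
  have hfε : ∀ k x, ε ≤ f k x + ε := fun k x => by linarith [hf0 k x]
  have hfg : ∀ k, Continuous (∇ (f k)) := fun k =>
    ((hf k).of_le (m := 1) (by norm_cast)).continuous_gradient
  have hsq : ∀ k, ∀ s : ℝ, Continuous fun x => (ζ x ^ 2 + d k) ^ s := by
    intro k s
    have h0 := hd0 k
    have : Continuous fun x => ζ x ^ 2 + d k := by fun_prop
    exact this.rpow_const fun x => Or.inl (by positivity)
  have hfp : ∀ k, ∀ s : ℝ, Continuous fun x => (f k x + ε) ^ s := fun k s =>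
    ((hf k).continuous.add continuous_const).rpow_const fun x =>
      Or.inl (hε.trans_le (hfε k x)).ne'
  have hfb : ∀ k x, ∀ s : ℝ, s ≤ 0 → (f k x + ε) ^ s ≤ ε ^ s := fun k x s hs =>
    Real.rpow_le_rpow_of_nonpos hε (hfε k x) hs
  have hζb : ∀ k x, ∀ s : ℝ, 0 ≤ s → (ζ x ^ 2 + d k) ^ s ≤ (M ^ 2 + 1) ^ s := by
    intro k x s hs
    have h1 : ζ x ^ 2 ≤ M ^ 2 := sq_le_sq' (by linarith [abs_le.1 (hM x)]) (abs_le.1 (hM x)).2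
    exact Real.rpow_le_rpow (by have := hd0 k; positivity) (by linarith [hd1 k]) hs
  have hflim : ∀ s : ℝ, ∀ᵐ x ∂μ,
      Tendsto (fun k => (f k x + ε) ^ s) atTop (𝓝 ((v x + ε) ^ s)) := by
    intro s
    filter_upwards [hfae, hv0] with x hx hx0
    exact (hx.add_const ε).rpow_const (Or.inl (by positivity))
  have hWG : Integrable (fun x => inner ℝ (W x) (G x)) μ := by
    refine memLp_one_iff_integrable.1 (MemLp.of_bilin (hpqr := hpq) (fun a b => inner ℝ a b) 1
      hWm hGm (hWm.1.inner hGm.1) (.of_forall fun x => ?_))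
    simpa using nnnorm_inner_le_nnnorm (𝕜 := ℝ) (W x) (G x)
  have hWint : Integrable W μ := hWm.integrable <| by
    rw [ENNReal.one_le_ofReal, one_le_div (by linarith)]
    linarith
  have hWf : ∀ k, Integrable (fun x => inner ℝ (W x) (∇ (f k) x)) μ := fun k =>
    Integrable.mono' (IntegrableOn.mul_continuousOn hWint.norm (hfg k).norm.continuousOn hK)
      (hWint.1.inner (hfg k).aestronglyMeasurable) (.of_forall fun x => norm_inner_le_norm _ _)
  -- The field $W=|G|^{p-2}G$ is a fixed element of the dual space $L^{p/(p-1)}$, so $L^p$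
  -- convergence of $\nabla f_k$ suffices.
  have hWconv : Tendsto (fun k => eLpNorm ((fun x => inner ℝ (W x) (∇ (f k) x)) -
      fun x => inner ℝ (W x) (G x)) 1 μ) atTop (𝓝 0) := by
    have h1 : Tendsto (fun k => eLpNorm W (ENNReal.ofReal (p / (p - 1))) μ *
        eLpNorm (∇ (f k) - G) (ENNReal.ofReal p) μ) atTop (𝓝 0) := by
      simpa using ENNReal.Tendsto.const_mul hfG (Or.inr hWm.2.ne)
    refine tendsto_of_tendsto_of_tendsto_of_le_of_le tendsto_const_nhds h1
      (fun _ => zero_le) fun k => ?_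
    have := eLpNorm_le_eLpNorm_mul_eLpNorm_of_nnnorm (hpqr := hpq) hWm.1
      ((hfg k).aestronglyMeasurable.sub hGm.1) (fun a b => inner ℝ a b) 1
      (.of_forall fun x => by simpa using nnnorm_inner_le_nnnorm (𝕜 := ℝ) (W x) _)
    simp only [Pi.sub_apply, inner_sub_right, ENNReal.coe_one, one_mul] at this
    exact this
  have hA := tendsto_integral_smul_of_tendsto_eLpNorm_one (μ := μ)
    (a := fun k x => regAbsPow p (d k) (ζ x) * (f k x + ε) ^ (-p))
    (a₀ := fun x => |ζ x| ^ p * (v x + ε) ^ (-p)) (C := (M ^ 2 + 1) ^ (p / 2) * ε ^ (-p))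
    (fun k => (((contDiff_regAbsPow (hd0 k)).continuous.comp hζc).mul
      (hfp k _)).aestronglyMeasurable)
    (fun k x => by
      have h0 := regAbsPow_nonneg hp0.le (hd0 k).le (ζ x)
      have h1 := Real.rpow_nonneg (hε.le.trans (hfε k x)) (-p)
      rw [Real.norm_of_nonneg (by positivity)]
      refine mul_le_mul ?_ (hfb k x _ (by linarith)) h1 (by positivity)
      refine le_trans ?_ (hζb k x _ (by positivity))
      exact sub_le_self _ (Real.rpow_nonneg (hd0 k).le _))
    (by
      filter_upwards [hflim (-p)] with x hx
      exact (tendsto_regAbsPow hd hp0 _).mul hx)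
    hWf hWG hWconv
  have hB := tendsto_integral_smul_of_tendsto_eLpNorm_one (μ := μ)
    (a := fun k x => (f k x + ε) ^ (1 - p) * (ζ x ^ 2 + d k) ^ ((p - 1) / 2))
    (a₀ := fun x => (v x + ε) ^ (1 - p) * |ζ x| ^ (p - 1))
    (C := ε ^ (1 - p) * (M ^ 2 + 1) ^ ((p - 1) / 2)) (h := fun _ x => ‖W x‖ * ‖∇ ζ x‖)
    (h₀ := fun x => ‖W x‖ * ‖∇ ζ x‖)
    (fun k => ((hfp k _).mul (hsq k _)).aestronglyMeasurable)
    (fun k x => by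
      have h1 := Real.rpow_nonneg (hε.le.trans (hfε k x)) (1 - p)
      have h2 : 0 ≤ (ζ x ^ 2 + d k) ^ ((p - 1) / 2) := by have := hd0 k; positivity
      rw [Real.norm_of_nonneg (by positivity)]
      exact mul_le_mul (hfb k x _ (by linarith)) (hζb k x _ (by linarith)) h2 (by positivity))
    (by
      filter_upwards [hflim (1 - p)] with x hx
      exact hx.mul (tendsto_sq_add_rpow hd hp1.le _))
    (fun _ => IntegrableOn.mul_continuousOn hWint.norm hζg.norm.continuousOn hK)
    (IntegrableOn.mul_continuousOn hWint.norm hζg.norm.continuousOn hK) (by simp)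
  have hlim := le_of_tendsto_of_tendsto' (hA.const_mul (p - 1)) (hB.const_mul p) fun k =>
    integral_inner_le_of_superharmonic_test hp hG hsup ζ (hf k) (hf0 k) hε (hd0 k)
  -- The a priori finiteness that absorption needs: $X\le(M/\varepsilon)|G|$. It would not be
  -- available with $\varepsilon=0$.
  have hXm : MemLp (fun x => |ζ x| * ‖G x‖ / (v x + ε)) (ENNReal.ofReal p) μ := by
    refine hGm.of_le_mul (c := M / ε) ?_ ?_
    · exact ((hζc.abs.aestronglyMeasurable.mul hGm.1.norm).aemeasurable.div
        (hvm.1.aemeasurable.add_const ε)).aestronglyMeasurable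
    · filter_upwards [hv0] with x hx
      rw [Real.norm_of_nonneg (by positivity), mul_comm (M / ε), ← mul_div_assoc, mul_comm ‖G x‖ M]
      have hMx : |ζ x| ≤ M := hM x
      have hM0 : 0 ≤ M := (abs_nonneg _).trans hMx
      exact div_le_div₀ (by positivity) (by gcongr) hε (by linarith)
  have hYm : MemLp (fun x => ‖∇ ζ x‖) (ENNReal.ofReal p) μ :=
    MemLp.of_bound hζg.norm.aestronglyMeasurable M'
      ((ae_restrict_iff' hK.measurableSet).2 (.of_forall fun x hx => by simpa using hM' x hx))
  have hX0 : 0 ≤ᵐ[μ] fun x => |ζ x| * ‖G x‖ / (v x + ε) := by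
    filter_upwards [hv0] with x hx
    simp only [Pi.zero_apply]
    positivity
  refine ⟨?_, integral_rpow_le_of_mul_integral_rpow_le hp hX0
    (.of_forall fun x => norm_nonneg _) hXm hYm ?_⟩
  · have := hXm.integrable_norm_rpow (by simpa using hp0) (by simp)
    rw [toReal_ofReal hp0.le] at this
    refine this.congr ?_
    filter_upwards [hX0] with x hx
    rw [Real.norm_of_nonneg hx]
  · have e1 : ∫ x, (|ζ x| * ‖G x‖ / (v x + ε)) ^ p ∂μ =
        ∫ x, (|ζ x| ^ p * (v x + ε) ^ (-p)) • inner ℝ (W x) (G x) ∂μ := by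
      refine integral_congr_ae ?_
      filter_upwards [hv0] with x hx
      rw [inner_norm_rpow_sub_two_smul hp, Real.div_rpow (by positivity) (by positivity),
        Real.mul_rpow (by positivity) (by positivity), Real.rpow_neg (by positivity), smul_eq_mul]
      ring
    have e2 : ∫ x, (|ζ x| * ‖G x‖ / (v x + ε)) ^ (p - 1) * ‖∇ ζ x‖ ∂μ =
        ∫ x, ((v x + ε) ^ (1 - p) * |ζ x| ^ (p - 1)) • (‖W x‖ * ‖∇ ζ x‖) ∂μ := by
      refine integral_congr_ae ?_
      filter_upwards [hv0] with x hx
      rw [norm_rpow_sub_two_smul hp, Real.div_rpow (by positivity) (by positivity),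
        Real.mul_rpow (by positivity) (by positivity), ← neg_sub p 1,
        Real.rpow_neg (by positivity), smul_eq_mul]
      ring
    rw [e1, e2]
    exact hlim

end Caccioppoli

/-! ### Integrability of a limit from a uniform bound. -/

section Fatou

variable {α : Type*} [MeasurableSpace α] {μ : Measure α}

theorem integrable_and_integral_le_of_tendsto {X : ℕ → α → ℝ} {X₀ : α → ℝ} {R : ℝ}
    (hX : ∀ k, Integrable (X k) μ) (h0 : ∀ k, 0 ≤ᵐ[μ] X k) (hR : ∀ k, ∫ x, X k x ∂μ ≤ R)
    (hlim : ∀ᵐ x ∂μ, Tendsto (fun k => X k x) atTop (𝓝 (X₀ x))) :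
    Integrable X₀ μ ∧ ∫ x, X₀ x ∂μ ≤ R := by
  have hX₀ : AEStronglyMeasurable X₀ μ :=
    aestronglyMeasurable_of_tendsto_ae atTop (fun k => (hX k).1) hlim
  have hX₀0 : 0 ≤ᵐ[μ] X₀ := by
    filter_upwards [hlim, ae_all_iff.2 h0] with x hx h using ge_of_tendsto' hx h
  have hR0 : 0 ≤ R := (integral_nonneg_of_ae (h0 0)).trans (hR 0)
  have h1 : ∫⁻ x, ENNReal.ofReal (X₀ x) ∂μ ≤ ENNReal.ofReal R := by
    calc ∫⁻ x, ENNReal.ofReal (X₀ x) ∂μ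
        = ∫⁻ x, liminf (fun k => ENNReal.ofReal (X k x)) atTop ∂μ := by
          refine lintegral_congr_ae ?_
          filter_upwards [hlim] with x hx
          exact ((ENNReal.continuous_ofReal.tendsto _).comp hx).liminf_eq.symm
      _ ≤ liminf (fun k => ∫⁻ x, ENNReal.ofReal (X k x) ∂μ) atTop :=
          lintegral_liminf_le' fun k => (hX k).1.aemeasurable.ennreal_ofReal
      _ ≤ ENNReal.ofReal R := by
          refine liminf_le_of_le (by isBoundedDefault) fun b hb => ?_
          obtain ⟨k, hk⟩ := hb.exists
          refine hk.trans ?_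
          rw [← ofReal_integral_eq_lintegral_ofReal (hX k) (h0 k)]
          exact ENNReal.ofReal_le_ofReal (hR k)
  have hint : Integrable X₀ μ := by
    refine ⟨hX₀, ?_⟩
    rw [hasFiniteIntegral_iff_ofReal hX₀0]
    exact h1.trans_lt ENNReal.ofReal_lt_top
  refine ⟨hint, ?_⟩
  rw [← ofReal_integral_eq_lintegral_ofReal hint hX₀0] at h1
  exact (ENNReal.ofReal_le_ofReal_iff hR0).1 h1

end Fatou

/-! ### A Poincaré inequality for double differences on balls. -/

section Poincare

variable {E : Type*} [NormedAddCommGroup E] [InnerProductSpace ℝ E] [FiniteDimensional ℝ E]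
  [MeasurableSpace E] [BorelSpace E] {μ : Measure E} [μ.IsAddHaarMeasure]

omit [MeasurableSpace E] [BorelSpace E] in
theorem enorm_sub_le_lintegral_enorm_gradient {f : E → ℝ} (hf : ContDiff ℝ 1 f) (x h : E) :
    ‖f (x + h) - f x‖ₑ ≤ ∫⁻ t in Ioc (0 : ℝ) 1, ‖h‖ₑ * ‖∇ f (x + t • h)‖ₑ := by
  have hd : ∀ t : ℝ, HasDerivAt (fun t : ℝ => f (x + t • h)) (inner ℝ (∇ f (x + t • h)) h) t := by
    intro t
    have h1 := hasGradientAt_iff_hasFDerivAt.1 (hf.hasGradientAt (x + t • h))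
    have h2 : HasDerivAt (fun t : ℝ => x + t • h) h t := by
      simpa using ((hasDerivAt_id t).smul_const h).const_add x
    exact h1.comp_hasDerivAt t h2
  have hc : Continuous fun t : ℝ => inner ℝ (∇ f (x + t • h)) h := by
    have := hf.continuous_gradient
    fun_prop
  have := intervalIntegral.integral_eq_sub_of_hasDerivAt (a := 0) (b := 1) (fun t _ => hd t)
    (hc.intervalIntegrable _ _)
  simp only [one_smul, zero_smul, add_zero] at this
  rw [← this, intervalIntegral.integral_of_le zero_le_one]
  refine (enorm_integral_le_lintegral_enorm _).trans (lintegral_mono fun t => ?_)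
  rw [mul_comm, ← ofReal_norm, ← ofReal_norm, ← ofReal_norm, ← ENNReal.ofReal_mul (norm_nonneg _)]
  exact ENNReal.ofReal_le_ofReal (norm_inner_le_norm _ _)

/-- Put $y=x+h$, so $|h|<2r$, and integrate the gradient along the segment, which stays in the ball
by convexity. No mean value of $f$ occurs, so the inequality can be applied before $\log v$ is known
to be integrable. -/
theorem lintegral_ball_lintegral_ball_enorm_sub_le {f : E → ℝ} (hf : ContDiff ℝ 1 f) (c : E)
    (r : ℝ) :
    ∫⁻ x in Metric.ball c r, ∫⁻ y in Metric.ball c r, ‖f y - f x‖ₑ ∂μ ∂μ ≤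
      ENNReal.ofReal (2 * r) * μ (Metric.ball 0 (2 * r)) *
        ∫⁻ x in Metric.ball c r, ‖∇ f x‖ₑ ∂μ := by
  set B := Metric.ball c r with hB
  have hBm : MeasurableSet B := Metric.isOpen_ball.measurableSet
  set D := Metric.ball (0 : E) (2 * r) with hD
  have hDm : MeasurableSet D := Metric.isOpen_ball.measurableSet
  set g : E → ℝ≥0∞ := B.indicator fun x => ‖∇ f x‖ₑ with hg
  have hgm : Measurable g := hf.continuous_gradient.measurable.enorm.indicator hBm
  have hpt : ∀ x ∈ B, ∀ h, B.indicator (fun y => ‖f y - f x‖ₑ) (x + h) ≤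
      D.indicator (fun _ => ENNReal.ofReal (2 * r)) h * ∫⁻ t in Ioc (0 : ℝ) 1, g (x + t • h) := by
    intro x hx h
    by_cases hy : x + h ∈ B
    swap
    · simp [hy]
    have hh : ‖h‖ < 2 * r := by
      have h1 := mem_ball_iff_norm.1 hx
      have h2 := mem_ball_iff_norm.1 hy
      calc ‖h‖ = ‖(x + h - c) - (x - c)‖ := by congr 1; abel
        _ ≤ _ := norm_sub_le _ _
        _ < _ := by linarith
    rw [indicator_of_mem hy, indicator_of_mem (show h ∈ D by simpa [hD] using hh),
      ← lintegral_const_mul' _ _ ENNReal.ofReal_ne_top]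
    refine (enorm_sub_le_lintegral_enorm_gradient hf x h).trans ?_
    refine setLIntegral_mono' measurableSet_Ioc fun t ht => ?_
    have hmem : x + t • h ∈ B := by
      have := (convex_ball c r).add_smul_sub_mem hx hy ⟨ht.1.le, ht.2⟩
      rwa [add_sub_cancel_left] at this
    rw [hg, indicator_of_mem hmem]
    gcongr
    rw [← ofReal_norm]
    exact ENNReal.ofReal_le_ofReal hh.le
  have hjm : Measurable fun z : E × E => ∫⁻ t in Ioc (0 : ℝ) 1, g (z.1 + t • z.2) := by
    refine Measurable.lintegral_prod_right' (f := fun w : (E × E) × ℝ => g (w.1.1 + w.2 • w.1.2)) ?_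
    exact hgm.comp (by fun_prop)
  have htm : ∀ h : E, Measurable fun z : E × ℝ => g (z.1 + z.2 • h) := fun h =>
    hgm.comp (by fun_prop)
  have hDi : Measurable (D.indicator fun _ : E => ENNReal.ofReal (2 * r)) :=
    measurable_const.indicator hDm
  calc ∫⁻ x in B, ∫⁻ y in B, ‖f y - f x‖ₑ ∂μ ∂μ
      = ∫⁻ x in B, ∫⁻ h, B.indicator (fun y => ‖f y - f x‖ₑ) (x + h) ∂μ ∂μ := by
        refine lintegral_congr fun x => ?_
        rw [lintegral_add_left_eq_self (μ := μ) (B.indicator (fun y => ‖f y - f x‖ₑ)) x,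
          lintegral_indicator hBm]
    _ ≤ ∫⁻ x in B, ∫⁻ h, D.indicator (fun _ => ENNReal.ofReal (2 * r)) h *
          (∫⁻ t in Ioc (0 : ℝ) 1, g (x + t • h)) ∂μ ∂μ :=
        setLIntegral_mono' hBm fun x hx => lintegral_mono fun h => hpt x hx h
    -- Since $g$ is extended by zero, $x$ may range over the whole space; for fixed $t$ and $h$
    -- translation invariance then removes the shift $th$.
    _ ≤ ∫⁻ x, ∫⁻ h, D.indicator (fun _ => ENNReal.ofReal (2 * r)) h *
          (∫⁻ t in Ioc (0 : ℝ) 1, g (x + t • h)) ∂μ ∂μ := setLIntegral_le_lintegral _ _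
    _ = ∫⁻ h, ∫⁻ x, D.indicator (fun _ => ENNReal.ofReal (2 * r)) h *
          (∫⁻ t in Ioc (0 : ℝ) 1, g (x + t • h)) ∂μ ∂μ :=
        lintegral_lintegral_swap ((hDi.comp measurable_snd).mul hjm).aemeasurable
    _ = ∫⁻ h, D.indicator (fun _ => ENNReal.ofReal (2 * r)) h * ∫⁻ x, g x ∂μ ∂μ := by
        refine lintegral_congr fun h => ?_
        rw [lintegral_const_mul _ (htm h).lintegral_prod_right',
          lintegral_lintegral_swap (htm h).aemeasurable]
        simp_rw [lintegral_add_right_eq_self (μ := μ) g]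
        simp
    _ = _ := by
        rw [lintegral_mul_const _ hDi, lintegral_indicator hDm, lintegral_indicator hBm]
        simp

end Poincare

/-! ### Removing $\varepsilon$ from the estimate; approximation of $\log(v+\varepsilon)$. -/

section Logarithm

variable {n : ℕ} {Ω : Opens (EuclideanSpace ℝ (Fin n))} {p : ℝ}
  {v : EuclideanSpace ℝ (Fin n) → ℝ} {G : EuclideanSpace ℝ (Fin n) → EuclideanSpace ℝ (Fin n)}

/-- The right side for $v+\varepsilon$ is free of $\varepsilon$, and the integrands converge
wherever $v>0$, so Fatou's lemma applies along $\varepsilon=1/(k+1)$. -/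
theorem integral_caccioppoli (hp : 1 < p) (hG : MemW1pWith p Ω v G)
    (hsup : ∀ φ : 𝓓(Ω, ℝ), (∀ x, 0 ≤ φ x) →
      0 ≤ ∫ x in (Ω : Set (EuclideanSpace ℝ (Fin n))), inner ℝ ((‖G x‖ ^ (p - 2)) • G x) (∇ φ x))
    (hpos : ∀ᵐ x ∂(volume.restrict (Ω : Set (EuclideanSpace ℝ (Fin n)))), 0 < v x)
    (ζ : 𝓓(Ω, ℝ)) :
    IntegrableOn (fun x => (|ζ x| * ‖G x‖ / v x) ^ p) (tsupport ζ) ∧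
    ∫ x in tsupport ζ, (|ζ x| * ‖G x‖ / v x) ^ p ≤
      (p / (p - 1)) ^ p * ∫ x in tsupport ζ, ‖∇ ζ x‖ ^ p := by
  have hv : ∀ᵐ x ∂(volume.restrict (tsupport ζ)), 0 < v x :=
    ae_mono (Measure.restrict_mono ζ.tsupport_subset le_rfl) hpos
  have h := fun k : ℕ => integral_caccioppoli_add_const hp hG hsup
    (hpos.mono fun _ hx => hx.le) ζ (Nat.one_div_pos_of_nat (α := ℝ) (n := k))
  refine integrable_and_integral_le_of_tendsto (fun k => (h k).1) (fun k => ?_)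
    (fun k => (h k).2) ?_
  · filter_upwards [hv] with x hx
    simp only [Pi.zero_apply]
    positivity
  · filter_upwards [hv] with x hx
    have h1 : Tendsto (fun k : ℕ => v x + 1 / ((k : ℝ) + 1)) atTop (𝓝 (v x + 0)) :=
      tendsto_const_nhds.add tendsto_one_div_add_atTop_nhds_zero_nat
    rw [add_zero] at h1
    exact (tendsto_const_nhds.div h1 hx.ne').rpow_const (Or.inr (by linarith))

/-- Where a cutoff exceeds $1/2$, $|G|/v\le 2t$ with $t=|\zeta||G|/v$, and $t\le 1+t^p$ is
integrable on the compact support. -/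
theorem locallyIntegrableOn_inv_smul (hp : 1 < p) (hG : MemW1pWith p Ω v G)
    (hpos : ∀ᵐ x ∂(volume.restrict (Ω : Set (EuclideanSpace ℝ (Fin n)))), 0 < v x)
    (hint : ∀ ζ : 𝓓(Ω, ℝ), IntegrableOn (fun x => (|ζ x| * ‖G x‖ / v x) ^ p) (tsupport ζ)) :
    LocallyIntegrableOn (fun x => (v x)⁻¹ • G x) (Ω : Set (EuclideanSpace ℝ (Fin n))) := by
  intro x hx
  obtain ⟨f, hfs, hfc, hf, -, hfx⟩ :=
    exists_contDiff_tsupport_subset (n := ⊤) (Ω.isOpen.mem_nhds hx)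
  let ζ : 𝓓(Ω, ℝ) := ⟨f, hf, hfc, hfs⟩
  have hK : IsCompact (tsupport ζ) := hfc
  have hle : volume.restrict (tsupport ζ) ≤
      volume.restrict (Ω : Set (EuclideanSpace ℝ (Fin n))) := Measure.restrict_mono hfs le_rfl
  have hfin : IsFiniteMeasure (volume.restrict (tsupport ζ)) :=
    isFiniteMeasure_restrict.2 hK.measure_lt_top.ne
  have hv : ∀ᵐ x ∂(volume.restrict (tsupport ζ)), 0 < v x := ae_mono hle hpos
  have hvm := (hG.memLp.mono_measure hle).1
  have hGm := (hG.memLp_gradient.mono_measure hle).1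
  have hGvm : AEStronglyMeasurable (fun x => (v x)⁻¹ • G x) (volume.restrict (tsupport ζ)) :=
    hvm.aemeasurable.inv.aestronglyMeasurable.smul hGm
  set s := {y | 1 / 2 < f y} with hs
  have hso : IsOpen s := isOpen_lt continuous_const hf.continuous
  have hsK : s ⊆ tsupport ζ := fun y hy => subset_tsupport f <| by
    rw [hs, mem_ofPred_eq] at hy
    rw [Function.mem_support]
    linarith
  refine ⟨s, mem_nhdsWithin_of_mem_nhds (hso.mem_nhds (by rw [hs, mem_ofPred_eq, hfx]; norm_num)), ?_⟩
  have hb : Integrable (fun x => 2 * (1 + (|ζ x| * ‖G x‖ / v x) ^ p))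
    (volume.restrict (tsupport ζ)) := ((integrable_const 1).add (hint ζ)).const_mul 2
  refine Integrable.mono' (IntegrableOn.mono_set hb hsK) (hGvm.mono_measure
    (Measure.restrict_mono hsK le_rfl)) ?_
  rw [ae_restrict_iff' hso.measurableSet]
  filter_upwards [(ae_restrict_iff' hK.measurableSet).1 hv] with y hy hys
  have hvy := hy (hsK hys)
  have hfy : 1 / 2 < |ζ y| := lt_of_lt_of_le hys (le_abs_self _)
  rw [norm_smul, Real.norm_of_nonneg (by positivity)]
  set t := |ζ y| * ‖G y‖ / v y with ht
  have ht0 : 0 ≤ t := by positivity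
  have h1 : t ≤ 1 + t ^ p := by
    rcases le_total t 1 with h | h
    · linarith [Real.rpow_nonneg ht0 p]
    · linarith [Real.self_le_rpow_of_one_le h hp.le]
  calc (v y)⁻¹ * ‖G y‖ = 2 * ((1 / 2) * ‖G y‖ / v y) := by ring
    _ ≤ 2 * t := by
      rw [ht]
      gcongr
    _ ≤ _ := by linarith

theorem abs_log_add_sub_log_add_le {a b ε : ℝ} (ha : 0 ≤ a) (hb : 0 ≤ b) (hε : 0 < ε) :
    |Real.log (a + ε) - Real.log (b + ε)| ≤ ε⁻¹ * |a - b| := by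
  have key : ∀ a b : ℝ, 0 ≤ a → 0 ≤ b →
      Real.log (a + ε) - Real.log (b + ε) ≤ ε⁻¹ * |a - b| := by
    intro a b ha hb
    have h1 : 0 < a + ε := by positivity
    have h2 : 0 < b + ε := by positivity
    rw [← Real.log_div h1.ne' h2.ne']
    calc _ ≤ (a + ε) / (b + ε) - 1 := Real.log_le_sub_one_of_pos (by positivity)
      _ = (a - b) / (b + ε) := by field_simp; ring
      _ ≤ |a - b| / ε := div_le_div₀ (abs_nonneg _) (le_abs_self _) hε (by linarith)
      _ = _ := by ring
  refine abs_le.2 ⟨?_, key a b ha hb⟩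
  have := key b a hb ha
  rw [abs_sub_comm] at this
  linarith

/-- Smooth approximation of `log (v + ε)` and of its weak gradient on compact subsets. -/
theorem exists_smooth_approximation_log_add (hp : 1 ≤ p) (hG : MemW1pWith p Ω v G)
    (hpos : ∀ᵐ x ∂(volume.restrict (Ω : Set (EuclideanSpace ℝ (Fin n)))), 0 ≤ v x)
    {K : Set (EuclideanSpace ℝ (Fin n))} (hK : IsCompact K) (hKΩ : K ⊆ Ω) {ε : ℝ} (hε : 0 < ε) :
    ∃ u : ℕ → EuclideanSpace ℝ (Fin n) → ℝ, (∀ k, ContDiff ℝ 1 (u k)) ∧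
      IntegrableOn (fun x => Real.log (v x + ε)) K ∧
      IntegrableOn (fun x => (v x + ε)⁻¹ • G x) K ∧
      Tendsto (fun k => eLpNorm (u k - fun x => Real.log (v x + ε)) 1 (volume.restrict K))
        atTop (𝓝 0) ∧
      Tendsto (fun k => eLpNorm (∇ (u k) - fun x => (v x + ε)⁻¹ • G x) 1 (volume.restrict K))
        atTop (𝓝 0) ∧
      (∀ᵐ x ∂(volume.restrict K),
        Tendsto (fun k => u k x) atTop (𝓝 (Real.log (v x + ε)))) := by
  have hle : volume.restrict K ≤ volume.restrict (Ω : Set (EuclideanSpace ℝ (Fin n))) :=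
    Measure.restrict_mono hKΩ le_rfl
  have hfin : IsFiniteMeasure (volume.restrict K) :=
    isFiniteMeasure_restrict.2 hK.measure_lt_top.ne
  have hp' : (1 : ℝ≥0∞) ≤ ENNReal.ofReal p := by simpa using hp
  have hv0 : ∀ᵐ x ∂(volume.restrict K), 0 ≤ v x := ae_mono hle hpos
  have hvm : MemLp v (ENNReal.ofReal p) (volume.restrict K) := hG.memLp.mono_measure hle
  have hGm : MemLp G (ENNReal.ofReal p) (volume.restrict K) := hG.memLp_gradient.mono_measure hle
  obtain ⟨f, hf, hf0, hfv, hfG, hfae⟩ := exists_smooth_approximation hp hG hpos hK hKΩ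
  have hf1 : ∀ k, ContDiff ℝ 1 (f k) := fun k => (hf k).of_le (by norm_cast)
  have hfε : ∀ k x, 0 < f k x + ε := fun k x => by linarith [hf0 k x]
  -- $K$ has finite measure, so $L^p$ convergence implies $L^1$ convergence.
  have hL1 : ∀ {F : Type} [NormedAddCommGroup F] (g : ℕ → EuclideanSpace ℝ (Fin n) → F),
      (∀ k, AEStronglyMeasurable (g k) (volume.restrict K)) →
      Tendsto (fun k => eLpNorm (g k) (ENNReal.ofReal p) (volume.restrict K)) atTop (𝓝 0) →
      Tendsto (fun k => eLpNorm (g k) 1 (volume.restrict K)) atTop (𝓝 0) := by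
    intro F _ g hgm hg
    set c := (volume.restrict K) univ ^ (1 / (1 : ℝ≥0∞).toReal - 1 / (ENNReal.ofReal p).toReal)
    have hc : c ≠ ⊤ := by
      refine ENNReal.rpow_ne_top_of_nonneg ?_ (measure_ne_top _ _)
      rw [toReal_ofReal (by linarith), toReal_one, sub_nonneg, div_one, div_le_one (by linarith)]
      exact hp
    have h2 : Tendsto (fun k => eLpNorm (g k) (ENNReal.ofReal p) (volume.restrict K) * c) atTop
        (𝓝 0) := by
      simpa using ENNReal.Tendsto.mul_const hg (Or.inr hc)
    exact tendsto_of_tendsto_of_tendsto_of_le_of_le tendsto_const_nhds h2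
      (fun _ => zero_le) fun k => eLpNorm_le_eLpNorm_mul_rpow_measure_univ hp' (hgm k)
  have hfv1 := hL1 _ (fun k => (hf k).continuous.aestronglyMeasurable.sub hvm.1) hfv
  have hfG1 := hL1 _ (fun k => (hf1 k).continuous_gradient.aestronglyMeasurable.sub hGm.1) hfG
  have hlogm : AEStronglyMeasurable (fun x => Real.log (v x + ε)) (volume.restrict K) :=
    (Real.measurable_log.comp_aemeasurable (hvm.1.aemeasurable.add_const ε)).aestronglyMeasurable
  have hinvm : AEStronglyMeasurable (fun x => (v x + ε)⁻¹) (volume.restrict K) :=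
    (hvm.1.aemeasurable.add_const ε).inv.aestronglyMeasurable
  have hgrad : ∀ k, ∇ (fun x => Real.log (f k x + ε)) = fun x => (f k x + ε)⁻¹ • ∇ (f k) x := by
    intro k
    ext1 x
    refine HasGradientAt.gradient (HasDerivAt.comp_hasGradientAt
      (g := fun s => Real.log (s + ε)) ?_ ((hf1 k).hasGradientAt x))
    simpa using ((hasDerivAt_id (f k x)).add_const ε).log (hfε k x).ne'
  refine ⟨fun k x => Real.log (f k x + ε), fun k => ((hf1 k).add contDiff_const).log
    fun x => (hfε k x).ne', ?_, ?_, ?_, ?_, ?_⟩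
  · have hb : Integrable (fun x => |Real.log ε| + ε⁻¹ * |v x|) (volume.restrict K) :=
      (integrable_const _).add ((hvm.integrable hp').abs.const_mul _)
    refine hb.mono' hlogm ?_
    filter_upwards [hv0] with x hx
    have h1 := abs_log_add_sub_log_add_le hx le_rfl hε
    rw [zero_add, sub_zero] at h1
    rw [Real.norm_eq_abs]
    linarith [abs_sub_abs_le_abs_sub (Real.log (v x + ε)) (Real.log ε)]
  · refine (hGm.integrable hp').bdd_smul ε⁻¹ hinvm ?_
    filter_upwards [hv0] with x hx
    rw [Real.norm_of_nonneg (by positivity)]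
    gcongr
    linarith
  · have h2 : Tendsto (fun k => ENNReal.ofReal ε⁻¹ * eLpNorm (f k - v) 1 (volume.restrict K))
        atTop (𝓝 0) := by
      simpa using ENNReal.Tendsto.const_mul hfv1 (Or.inr ENNReal.ofReal_ne_top)
    refine tendsto_of_tendsto_of_tendsto_of_le_of_le tendsto_const_nhds h2
      (fun _ => zero_le) fun k => eLpNorm_le_mul_eLpNorm_of_ae_le_mul ?_ 1
    filter_upwards [hv0] with x hx
    exact abs_log_add_sub_log_add_le (hf0 k x) hx hε
  · simp only [hgrad]
    refine tendsto_eLpNorm_one_smul_sub (C := ε⁻¹) (fun k => ?_) (fun k x => ?_) ?_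
      (hGm.integrable hp') hfG1
    · exact (((hf k).continuous.add continuous_const).inv₀
        fun x => (hfε k x).ne').aestronglyMeasurable
    · have := hfε k x
      rw [Real.norm_of_nonneg (by positivity)]
      gcongr
      linarith [hf0 k x]
    · filter_upwards [hfae, hv0] with x hx hx0
      exact (hx.add_const ε).inv₀ (by positivity)
  · filter_upwards [hfae, hv0] with x hx hx0
    exact (hx.add_const ε).log (by positivity)

end Logarithm

/-! ### Local integrability and weak gradient of $\log v$. -/

section WeakGradient

variable {n : ℕ} {Ω : Opens (EuclideanSpace ℝ (Fin n))} {p : ℝ}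
  {v : EuclideanSpace ℝ (Fin n) → ℝ} {G : EuclideanSpace ℝ (Fin n) → EuclideanSpace ℝ (Fin n)}

theorem eLpNorm_le_of_tendsto_ae {α F : Type*} [MeasurableSpace α] {μ : Measure α}
    [NormedAddCommGroup F] {q : ℝ≥0∞} {f : ℕ → α → F} {f₀ : α → F} {b : ℕ → ℝ≥0∞} {b₀ : ℝ≥0∞}
    (hf : ∀ k, AEStronglyMeasurable (f k) μ)
    (hlim : ∀ᵐ x ∂μ, Tendsto (fun k => f k x) atTop (𝓝 (f₀ x)))
    (hb : ∀ k, eLpNorm (f k) q μ ≤ b k) (hb₀ : Tendsto b atTop (𝓝 b₀)) :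
    eLpNorm f₀ q μ ≤ b₀ := by
  rw [← hb₀.liminf_eq]
  exact (Lp.eLpNorm_lim_le_liminf_eLpNorm hf _ hlim).trans (liminf_le_liminf (.of_forall hb))

/-- The Poincaré inequality bounds the double differences of $\log(v+\varepsilon)$ by
$\int|G|/(v+\varepsilon)\le\int|G|/v$, uniformly in $\varepsilon$. Fatou's lemma on the product then
handles $\log v$ itself. -/
theorem MemW1pWith.locallyIntegrableOn_log (hp : 1 ≤ p) (hG : MemW1pWith p Ω v G)
    (hpos : ∀ᵐ x ∂(volume.restrict (Ω : Set (EuclideanSpace ℝ (Fin n)))), 0 < v x)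
    (hloc : LocallyIntegrableOn (fun x => (v x)⁻¹ • G x)
      (Ω : Set (EuclideanSpace ℝ (Fin n)))) :
    LocallyIntegrableOn (fun x => Real.log (v x)) (Ω : Set (EuclideanSpace ℝ (Fin n))) := by
  intro x₀ hx₀
  obtain ⟨r, hr, hrΩ⟩ := Metric.nhds_basis_closedBall.mem_iff.1 (Ω.isOpen.mem_nhds hx₀)
  refine ⟨Metric.ball x₀ r, mem_nhdsWithin_of_mem_nhds (Metric.ball_mem_nhds x₀ hr), ?_⟩
  set K := Metric.closedBall x₀ r with hKdef
  have hK : IsCompact K := isCompact_closedBall x₀ r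
  set ν := volume.restrict (Metric.ball x₀ r) with hν
  have hνK : ν ≤ volume.restrict K := Measure.restrict_mono Metric.ball_subset_closedBall le_rfl
  have hKΩ : volume.restrict K ≤ volume.restrict (Ω : Set (EuclideanSpace ℝ (Fin n))) :=
    Measure.restrict_mono hrΩ le_rfl
  have hvK : ∀ᵐ x ∂(volume.restrict K), 0 < v x := ae_mono hKΩ hpos
  have hvν : ∀ᵐ x ∂ν, 0 < v x := ae_mono hνK hvK
  have hνfin : IsFiniteMeasure ν := isFiniteMeasure_restrict.2 Metric.isBounded_ball.measure_lt_top.ne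
  have hGK : IntegrableOn (fun x => (v x)⁻¹ • G x) K := hloc.integrableOn_compact_subset hrΩ hK
  have hGm : AEStronglyMeasurable G (volume.restrict K) :=
    (hG.memLp_gradient.mono_measure hKΩ).1
  have hvm : AEStronglyMeasurable v ν := (hG.memLp.mono_measure (hνK.trans hKΩ)).1
  set C : ℝ≥0∞ := ENNReal.ofReal (2 * r) *
    volume (Metric.ball (0 : EuclideanSpace ℝ (Fin n)) (2 * r)) with hC
  have hCtop : C ≠ ⊤ := ENNReal.mul_ne_top ENNReal.ofReal_ne_top Metric.isBounded_ball.measure_lt_top.ne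
  set M := eLpNorm (fun x => (v x)⁻¹ • G x) 1 (volume.restrict K) with hM
  have hMtop : M ≠ ⊤ := (memLp_one_iff_integrable.2 hGK).2.ne
  have hprodm : ∀ {w : EuclideanSpace ℝ (Fin n) → ℝ}, AEStronglyMeasurable w ν →
      AEStronglyMeasurable (fun z : EuclideanSpace ℝ (Fin n) × EuclideanSpace ℝ (Fin n) =>
        w z.2 - w z.1) (ν.prod ν) := fun hw => hw.comp_snd.sub hw.comp_fst
  have hprodae : ∀ {P : EuclideanSpace ℝ (Fin n) → Prop}, (∀ᵐ x ∂ν, P x) →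
      ∀ᵐ z ∂(ν.prod ν), P z.1 ∧ P z.2 := fun hP =>
    (Measure.quasiMeasurePreserving_fst.ae hP).and (Measure.quasiMeasurePreserving_snd.ae hP)
  have hε : ∀ ε : ℝ, 0 < ε → eLpNorm (fun z : EuclideanSpace ℝ (Fin n) × EuclideanSpace ℝ (Fin n) =>
      Real.log (v z.2 + ε) - Real.log (v z.1 + ε)) 1 (ν.prod ν) ≤ C * M := by
    intro ε hε
    obtain ⟨u, hu, -, hgint, -, hug, huae⟩ := exists_smooth_approximation_log_add hp hG
      (hpos.mono fun _ h => h.le) hK hrΩ hε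
    set g := fun x => (v x + ε)⁻¹ • G x
    have hgM : eLpNorm g 1 (volume.restrict K) ≤ M := by
      refine eLpNorm_mono_ae ?_
      filter_upwards [hvK] with x hx
      simp only [g]
      rw [norm_smul, norm_smul, Real.norm_of_nonneg (by positivity),
        Real.norm_of_nonneg (by positivity)]
      gcongr
      linarith
    have hb : Tendsto (fun k => C * (eLpNorm (∇ (u k) - g) 1 (volume.restrict K) + M)) atTop
        (𝓝 (C * (0 + M))) :=
      ENNReal.Tendsto.const_mul (hug.add tendsto_const_nhds) (Or.inr hCtop)
    rw [zero_add] at hb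
    refine eLpNorm_le_of_tendsto_ae
      (fun k => hprodm (hu k).continuous.aestronglyMeasurable) ?_ (fun k => ?_) hb
    · filter_upwards [hprodae (ae_mono hνK huae)] with z hz
      exact hz.2.sub hz.1
    · rw [eLpNorm_one_eq_lintegral_enorm,
        lintegral_prod _ (hprodm (hu k).continuous.aestronglyMeasurable).enorm]
      refine (lintegral_ball_lintegral_ball_enorm_sub_le (hu k) x₀ r).trans ?_
      gcongr
      rw [← eLpNorm_one_eq_lintegral_enorm]
      calc eLpNorm (∇ (u k)) 1 ν ≤ eLpNorm (∇ (u k)) 1 (volume.restrict K) :=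
            eLpNorm_mono_measure _ hνK
        _ = eLpNorm ((∇ (u k) - g) + g) 1 (volume.restrict K) := by rw [sub_add_cancel]
        _ ≤ eLpNorm (∇ (u k) - g) 1 (volume.restrict K) + eLpNorm g 1 (volume.restrict K) :=
            eLpNorm_add_le ((hu k).continuous_gradient.aestronglyMeasurable.sub hgint.1) hgint.1
              le_rfl
        _ ≤ _ := by gcongr
  have hlogm : ∀ ε : ℝ, AEStronglyMeasurable (fun x => Real.log (v x + ε)) ν := fun ε =>
    (Real.measurable_log.comp_aemeasurable (hvm.aemeasurable.add_const ε)).aestronglyMeasurable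
  have hlog0 : AEStronglyMeasurable (fun x => Real.log (v x)) ν := by simpa using hlogm 0
  have hfinal : eLpNorm (fun z : EuclideanSpace ℝ (Fin n) × EuclideanSpace ℝ (Fin n) =>
      Real.log (v z.2) - Real.log (v z.1)) 1 (ν.prod ν) ≤ C * M := by
    refine eLpNorm_le_of_tendsto_ae (fun k : ℕ => hprodm (hlogm (1 / ((k : ℝ) + 1)))) ?_
      (fun k => hε _ Nat.one_div_pos_of_nat) tendsto_const_nhds
    have hlim : ∀ᵐ x ∂ν, Tendsto (fun k : ℕ => Real.log (v x + 1 / ((k : ℝ) + 1))) atTop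
        (𝓝 (Real.log (v x))) := by
      filter_upwards [hvν] with x hx
      have h1 : Tendsto (fun k : ℕ => v x + 1 / ((k : ℝ) + 1)) atTop (𝓝 (v x + 0)) :=
        tendsto_const_nhds.add tendsto_one_div_add_atTop_nhds_zero_nat
      rw [add_zero] at h1
      exact h1.log hx.ne'
    filter_upwards [hprodae hlim] with z hz
    exact hz.2.sub hz.1
  have hint : Integrable (fun z : EuclideanSpace ℝ (Fin n) × EuclideanSpace ℝ (Fin n) =>
      Real.log (v z.2) - Real.log (v z.1)) (ν.prod ν) :=
    memLp_one_iff_integrable.1 ⟨hprodm hlog0, hfinal.trans_lt (ENNReal.mul_lt_top hCtop.lt_top hMtop.lt_top)⟩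
  have hne : (ae ν).NeBot := by
    rw [ae_neBot, hν, Ne, Measure.restrict_eq_zero]
    exact (Metric.measure_ball_pos volume x₀ hr).ne'
  -- By Fubini some slice $y\mapsto\log v(y)-\log v(x)$ is integrable; adding the constant $\log
  -- v(x)$ recovers $\log v$ on the ball.
  obtain ⟨x, hx⟩ := hint.prod_right_ae.exists
  refine (hx.add (integrable_const (Real.log (v x)))).congr (.of_forall fun y => ?_)
  simp

theorem integral_smul_gradient_eq_neg {u φ : EuclideanSpace ℝ (Fin n) → ℝ} (hu : ContDiff ℝ 1 u)
    (hφ : ContDiff ℝ 1 φ) (hc : HasCompactSupport φ) :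
    ∫ x, u x • ∇ φ x = - ∫ x, φ x • ∇ u x := by
  have hcg : HasCompactSupport (∇ φ) := hc.mono' (support_gradient_subset φ)
  have h1 : Integrable fun x => u x • ∇ φ x :=
    (hu.continuous.smul hφ.continuous_gradient).integrable_of_hasCompactSupport hcg.smul_left
  have h2 : Integrable fun x => φ x • ∇ u x :=
    (hφ.continuous.smul hu.continuous_gradient).integrable_of_hasCompactSupport hc.smul_right
  refine ext_inner_left ℝ fun a => ?_
  rw [inner_neg_right, ← integral_inner h1, ← integral_inner h2]
  simp only [inner_smul_right, inner_gradient_right, conj_trivial]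
  have h1' : Integrable fun x => u x * fderiv ℝ φ x a := by
    simpa [inner_smul_right, inner_gradient_right] using h1.const_inner (𝕜 := ℝ) a
  have h2' : Integrable fun x => φ x * fderiv ℝ u x a := by
    simpa [inner_smul_right, inner_gradient_right] using h2.const_inner (𝕜 := ℝ) a
  rw [integral_mul_fderiv_eq_neg_fderiv_mul_of_integrable (by simpa only [mul_comm] using h2') h1'
    ((hu.continuous.mul hφ.continuous).integrable_of_hasCompactSupport hc.mul_left)
    (fun x _ => hu.differentiable one_ne_zero x) (fun x _ => hφ.differentiable one_ne_zero x)]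
  simp only [mul_comm]

theorem setIntegral_eq_setIntegral_tsupport {F : Type*} [NormedAddCommGroup F] [NormedSpace ℝ F]
    (φ : 𝓓(Ω, ℝ)) {w : EuclideanSpace ℝ (Fin n) → F} (hw : ∀ x ∉ tsupport φ, w x = 0) :
    ∫ x in (Ω : Set (EuclideanSpace ℝ (Fin n))), w x = ∫ x in tsupport φ, w x :=
  setIntegral_eq_of_subset_of_forall_sdiff_eq_zero Ω.isOpen.measurableSet φ.tsupport_subset
    fun x hx => hw x hx.2

theorem TestFunction.gradient_eq_zero_of_notMem (φ : 𝓓(Ω, ℝ)) {x : EuclideanSpace ℝ (Fin n)}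
    (hx : x ∉ tsupport φ) : ∇ φ x = 0 := by
  by_contra h
  exact hx (support_gradient_subset φ h)

theorem TestFunction.continuous_gradient (φ : 𝓓(Ω, ℝ)) : Continuous (∇ φ) :=
  ContDiff.continuous_gradient (φ.contDiff.of_le (m := 1) (by norm_cast))

theorem MemW1pWith.setIntegral_log_add_smul_gradient (hp : 1 ≤ p) (hG : MemW1pWith p Ω v G)
    (hpos : ∀ᵐ x ∂(volume.restrict (Ω : Set (EuclideanSpace ℝ (Fin n)))), 0 ≤ v x)
    {ε : ℝ} (hε : 0 < ε) (φ : 𝓓(Ω, ℝ)) :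
    ∫ x in tsupport φ, Real.log (v x + ε) • ∇ φ x =
      - ∫ x in tsupport φ, φ x • (v x + ε)⁻¹ • G x := by
  have hK : IsCompact (tsupport φ) := φ.hasCompactSupport
  obtain ⟨u, hu, hlint, hgint, hul, hug, -⟩ := exists_smooth_approximation_log_add hp hG hpos hK
    φ.tsupport_subset hε
  obtain ⟨A, hA⟩ := φ.hasCompactSupport.exists_bound_of_continuous φ.continuous
  obtain ⟨B, hB⟩ := HasCompactSupport.exists_bound_of_continuous
    (φ.hasCompactSupport.mono' (support_gradient_subset φ)) φ.continuous_gradient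
  have h1 : Tendsto (fun k => ∫ x in tsupport φ, φ x • ∇ (u k) x) atTop
      (𝓝 (∫ x in tsupport φ, φ x • (v x + ε)⁻¹ • G x)) :=
    tendsto_integral_smul_of_tendsto_eLpNorm_one (a := fun _ => φ)
      (fun _ => φ.continuous.aestronglyMeasurable) (fun _ => hA)
      (.of_forall fun _ => tendsto_const_nhds)
      (fun k => (hu k).continuous_gradient.continuousOn.integrableOn_compact hK) hgint hug
  have h2 : Tendsto (fun k => ∫ x in tsupport φ, u k x • ∇ φ x) atTop
      (𝓝 (∫ x in tsupport φ, Real.log (v x + ε) • ∇ φ x)) := by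
    refine tendsto_integral_of_L1' _ (hlint.1.smul φ.continuous_gradient.aestronglyMeasurable)
      (.of_forall fun k => ((hu k).continuous.smul
        φ.continuous_gradient).continuousOn.integrableOn_compact hK) ?_
    have h3 : Tendsto (fun k => ENNReal.ofReal B * eLpNorm (u k - fun x => Real.log (v x + ε)) 1
        (volume.restrict (tsupport φ))) atTop (𝓝 0) := by
      simpa using ENNReal.Tendsto.const_mul hul (Or.inr ENNReal.ofReal_ne_top)
    refine tendsto_of_tendsto_of_tendsto_of_le_of_le tendsto_const_nhds h3
      (fun _ => zero_le) fun k => eLpNorm_le_mul_eLpNorm_of_ae_le_mul (.of_forall fun x => ?_) 1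
    simp only [Pi.sub_apply, Pi.smul_apply']
    rw [← sub_smul, norm_smul, mul_comm]
    gcongr
    exact hB x
  refine tendsto_nhds_unique h2 (h1.neg.congr fun k => ?_)
  have h4 := integral_smul_gradient_eq_neg (hu k) (φ.contDiff.of_le (m := 1) (by norm_cast))
    φ.hasCompactSupport
  rw [setIntegral_eq_integral_of_forall_compl_eq_zero fun x hx => ?_,
    setIntegral_eq_integral_of_forall_compl_eq_zero fun x hx => ?_, h4]
  · rw [φ.gradient_eq_zero_of_notMem hx, smul_zero]
  · rw [image_eq_zero_of_notMem_tsupport hx, zero_smul]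

/-- With both sides now known to be locally integrable, the identity for $\log(v+\varepsilon)$
passes to $\varepsilon\to0$ by dominated convergence. -/
theorem MemW1pWith.hasWeakGradient_log (hp : 1 ≤ p) (hG : MemW1pWith p Ω v G)
    (hpos : ∀ᵐ x ∂(volume.restrict (Ω : Set (EuclideanSpace ℝ (Fin n)))), 0 < v x)
    (hloc : LocallyIntegrableOn (fun x => (v x)⁻¹ • G x)
      (Ω : Set (EuclideanSpace ℝ (Fin n)))) :
    HasWeakGradient Ω (fun x => Real.log (v x)) (fun x => (v x)⁻¹ • G x) := by
  have hlog := hG.locallyIntegrableOn_log hp hpos hloc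
  refine ⟨hlog, hloc, fun φ => ?_⟩
  have hK : IsCompact (tsupport φ) := φ.hasCompactSupport
  have hle : volume.restrict (tsupport φ) ≤
      volume.restrict (Ω : Set (EuclideanSpace ℝ (Fin n))) :=
    Measure.restrict_mono φ.tsupport_subset le_rfl
  have hfin : IsFiniteMeasure (volume.restrict (tsupport φ)) :=
    isFiniteMeasure_restrict.2 hK.measure_lt_top.ne
  have hv : ∀ᵐ x ∂(volume.restrict (tsupport φ)), 0 < v x := ae_mono hle hpos
  have hvm := hG.memLp.mono_measure hle
  have hGm := hG.memLp_gradient.mono_measure hle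
  rw [setIntegral_eq_setIntegral_tsupport φ fun x hx => by
      rw [φ.gradient_eq_zero_of_notMem hx, smul_zero],
    setIntegral_eq_setIntegral_tsupport φ fun x hx => by
      rw [image_eq_zero_of_notMem_tsupport hx, zero_smul]]
  have hlogK := hlog.integrableOn_compact_subset φ.tsupport_subset hK
  have hlocK := hloc.integrableOn_compact_subset φ.tsupport_subset hK
  have hε0 : ∀ k : ℕ, (0 : ℝ) < 1 / ((k : ℝ) + 1) := fun k => by positivity
  have hε1 : ∀ k : ℕ, 1 / ((k : ℝ) + 1) ≤ 1 := fun k => by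
    rw [div_le_one (by positivity)]
    linarith [(Nat.cast_nonneg k : (0 : ℝ) ≤ k)]
  have hlim : ∀ x, Tendsto (fun k : ℕ => v x + 1 / ((k : ℝ) + 1)) atTop (𝓝 (v x)) := fun x => by
    have h1 : Tendsto (fun k : ℕ => v x + 1 / ((k : ℝ) + 1)) atTop (𝓝 (v x + 0)) :=
      tendsto_const_nhds.add tendsto_one_div_add_atTop_nhds_zero_nat
    rwa [add_zero] at h1
  have h1 : Tendsto (fun k : ℕ => ∫ x in tsupport φ, Real.log (v x + 1 / ((k : ℝ) + 1)) • ∇ φ x)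
      atTop (𝓝 (∫ x in tsupport φ, Real.log (v x) • ∇ φ x)) := by
    refine tendsto_integral_of_dominated_convergence
      -- For $0<\varepsilon\le1$, $\log v\le\log(v+\varepsilon)\le v+\varepsilon-1\le v$.
      (fun x => (|Real.log (v x)| + |v x|) * ‖∇ φ x‖) (fun k => ?_) ?_ (fun k => ?_) ?_
    · exact (Real.measurable_log.comp_aemeasurable
        (hvm.1.aemeasurable.add_const _)).aestronglyMeasurable.smul
        φ.continuous_gradient.aestronglyMeasurable
    · exact IntegrableOn.mul_continuousOn
        (hlogK.abs.add (hvm.integrable (by simpa using hp)).abs)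
        φ.continuous_gradient.norm.continuousOn hK
    · filter_upwards [hv] with x hx
      rw [norm_smul]
      gcongr
      have h2 : Real.log (v x) ≤ Real.log (v x + 1 / ((k : ℝ) + 1)) :=
        Real.log_le_log hx (by linarith [hε0 k])
      have h3 := Real.log_le_sub_one_of_pos (show 0 < v x + 1 / ((k : ℝ) + 1) by
        linarith [hε0 k])
      rw [Real.norm_eq_abs, abs_le, abs_of_pos hx]
      constructor
      · linarith [neg_abs_le (Real.log (v x))]
      · linarith [abs_nonneg (Real.log (v x)), hε1 k]
    · filter_upwards [hv] with x hx
      exact ((hlim x).log hx.ne').smul_const _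
  have h2 : Tendsto (fun k : ℕ => ∫ x in tsupport φ, φ x • (v x + 1 / ((k : ℝ) + 1))⁻¹ • G x)
      atTop (𝓝 (∫ x in tsupport φ, φ x • (v x)⁻¹ • G x)) := by
    refine tendsto_integral_of_dominated_convergence
      (fun x => ‖φ x • (v x)⁻¹ • G x‖) (fun k => ?_) ?_ (fun k => ?_) ?_
    · exact φ.continuous.aestronglyMeasurable.smul
        ((hvm.1.aemeasurable.add_const _).inv.aestronglyMeasurable.smul hGm.1)
    · exact (IntegrableOn.continuousOn_smul hlocK φ.continuous.continuousOn hK).norm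
    · filter_upwards [hv] with x hx
      have := hε0 k
      rw [norm_smul, norm_smul, norm_smul, norm_smul, norm_inv, norm_inv,
        Real.norm_of_nonneg (r := v x) hx.le,
        Real.norm_of_nonneg (r := v x + 1 / ((k : ℝ) + 1)) (by positivity)]
      gcongr
      linarith
    · filter_upwards [hv] with x hx
      exact (((hlim x).inv₀ hx.ne').smul_const _).const_smul _
  refine tendsto_nhds_unique h1 (h2.neg.congr fun k => ?_)
  exact (hG.setIntegral_log_add_smul_gradient hp (hpos.mono fun _ h => h.le) (hε0 k) φ).symm

/-- The difference of the two gradients integrates to zero against every test function, so the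
fundamental lemma of the calculus of variations applies. -/
theorem HasWeakGradient.ae_eq {u : EuclideanSpace ℝ (Fin n) → ℝ}
    {G₁ G₂ : EuclideanSpace ℝ (Fin n) → EuclideanSpace ℝ (Fin n)} (h₁ : HasWeakGradient Ω u G₁)
    (h₂ : HasWeakGradient Ω u G₂) :
    ∀ᵐ x, x ∈ (Ω : Set (EuclideanSpace ℝ (Fin n))) → G₁ x = G₂ x := by
  have key := Ω.isOpen.ae_eq_zero_of_integral_contDiff_smul_eq_zero
    (h₁.locallyIntegrableOn_gradient.sub h₂.locallyIntegrableOn_gradient) (μ := volume) ?_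
  · filter_upwards [key] with x hx hxΩ
    exact sub_eq_zero.1 (hx hxΩ)
  intro g hg hgc hgs
  let φ : 𝓓(Ω, ℝ) := ⟨g, hg, hgc, hgs⟩
  have hK : IsCompact (tsupport φ) := hgc
  have e := (h₁.integral_smul_gradient φ).symm.trans (h₂.integral_smul_gradient φ)
  rw [neg_inj] at e
  have hz : ∀ w : EuclideanSpace ℝ (Fin n) → EuclideanSpace ℝ (Fin n), ∀ x ∉ tsupport φ,
      φ x • w x = 0 := fun w x hx => by rw [image_eq_zero_of_notMem_tsupport hx, zero_smul]
  rw [setIntegral_eq_setIntegral_tsupport φ (hz _),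
    setIntegral_eq_setIntegral_tsupport φ (hz _)] at e
  have hi : ∀ w : EuclideanSpace ℝ (Fin n) → EuclideanSpace ℝ (Fin n), LocallyIntegrableOn w (Ω : Set (EuclideanSpace ℝ (Fin n))) →
      IntegrableOn (fun x => φ x • w x) (tsupport φ) := fun w hw =>
    IntegrableOn.continuousOn_smul (hw.integrableOn_compact_subset φ.tsupport_subset hK)
      φ.continuous.continuousOn hK
  change ∫ x, φ x • (G₁ - G₂) x = 0
  rw [← setIntegral_eq_integral_of_forall_compl_eq_zero (s := tsupport φ) (hz (G₁ - G₂))]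
  simp only [Pi.sub_apply, smul_sub]
  rw [integral_sub (hi _ h₁.locallyIntegrableOn_gradient) (hi _ h₂.locallyIntegrableOn_gradient),
    sub_eq_zero]
  exact e

end WeakGradient

/-! ### The estimate for an arbitrary weak gradient of $\log v$. -/

theorem mainTheorem4 {n : ℕ} (Ω : Opens (EuclideanSpace ℝ (Fin n))) (p : ℝ) (hp : 1 < p)
    (v : EuclideanSpace ℝ (Fin n) → ℝ) (hv : IsPSuperharmonic p Ω v)
    (hpos : ∀ᵐ x ∂(volume.restrict (Ω : Set (EuclideanSpace ℝ (Fin n)))), 0 < v x) :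
    (∃ L : EuclideanSpace ℝ (Fin n) → EuclideanSpace ℝ (Fin n),
      HasWeakGradient Ω (fun x => Real.log (v x)) L) ∧
    ∀ L : EuclideanSpace ℝ (Fin n) → EuclideanSpace ℝ (Fin n),
      HasWeakGradient Ω (fun x => Real.log (v x)) L →
      ∀ ζ : 𝓓(Ω, ℝ),
        IntegrableOn (fun x => ‖ζ x • L x‖ ^ p) (Ω : Set (EuclideanSpace ℝ (Fin n))) volume ∧
        ∫ x in (Ω : Set (EuclideanSpace ℝ (Fin n))), ‖ζ x • L x‖ ^ p ≤
          (p / (p - 1)) ^ p *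
            ∫ x in (Ω : Set (EuclideanSpace ℝ (Fin n))), ‖∇ ζ x‖ ^ p := by
  obtain ⟨G, hG, hsup⟩ := hv
  have hcac := integral_caccioppoli hp hG hsup hpos
  have hloc := locallyIntegrableOn_inv_smul hp hG hpos fun ζ => (hcac ζ).1
  have hw := hG.hasWeakGradient_log hp.le hpos hloc
  refine ⟨⟨_, hw⟩, fun L hL ζ => ?_⟩
  have hp0 : p ≠ 0 := by linarith
  have hKm : MeasurableSet (tsupport ζ) := (isClosed_tsupport ζ).measurableSet
  have hz : ∀ x ∉ tsupport ζ, ‖ζ x • L x‖ ^ p = 0 := fun x hx => by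
    rw [image_eq_zero_of_notMem_tsupport hx, zero_smul, norm_zero, Real.zero_rpow hp0]
  have hz' : ∀ x ∉ tsupport ζ, ‖∇ ζ x‖ ^ p = 0 := fun x hx => by
    rw [ζ.gradient_eq_zero_of_notMem hx, norm_zero, Real.zero_rpow hp0]
  -- Uniqueness identifies $L$ with $G/v$ almost everywhere, so the estimate already proved applies
  -- to it.
  have hae : (fun x => ‖ζ x • L x‖ ^ p) =ᵐ[volume.restrict (tsupport ζ)]
      fun x => (|ζ x| * ‖G x‖ / v x) ^ p := by
    have hv : ∀ᵐ x ∂(volume.restrict (tsupport ζ)), 0 < v x :=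
      ae_mono (Measure.restrict_mono ζ.tsupport_subset le_rfl) hpos
    filter_upwards [hv, ae_restrict_of_ae (hL.ae_eq hw), ae_restrict_mem hKm] with x hx hLx hxK
    rw [hLx (ζ.tsupport_subset hxK), norm_smul, norm_smul, norm_inv, Real.norm_of_nonneg hx.le,
      Real.norm_eq_abs]
    ring_nf
  rw [setIntegral_eq_setIntegral_tsupport ζ hz, setIntegral_eq_setIntegral_tsupport ζ hz',
    integral_congr_ae hae]
  refine ⟨?_, (hcac ζ).2⟩
  exact IntegrableOn.of_forall_sdiff_eq_zero ((hcac ζ).1.congr hae.symm) Ω.isOpen.measurableSet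
    fun x hx => hz x hx.2
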